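/- Let $\mathbb L^3$ be $\mathbb R^3$ with the Lorentzian metric $\langle\cdot,\cdot\rangle=dx_1^2+dx_2^2-dx_3^2$. A (non-degenerate) rotational surface is the orbit of a regular $C^2$ curve $\gamma:I\to\mathbb L^3$ ($I$ an open interval), whose velocity is everywhere spacelike or everywhere timelike, under the one-parameter group of rotations fixing pointwise a line $l$ (the axis); $\gamma$ lies in an open half-plane bounded by $l$ of a non-degenerate plane. Up to an isometry of $\mathbb L^3$ it is of one of four classes, where $t\in\mathbb R$: * (I) hyperbolic of first type, $l$ the $x_1$-axis: $X(s,t)=(x(s),z(s)\sinh t,z(s)\cosh t)$, $z>0$; * (II) hyperbolic of second type, $l$ the $x_1$-axis: $X(s,t)=(x(s),y(s)\cosh t,y(s)\sinh t)$, $y>0$; * (III) elliptic, $l$ the $x_3$-axis: $X(s,t)=(x(s)\cos t,x(s)\sin t,z(s))$, $x>0$; * (IV) parabolic, $l=\mathrm{span}(1,0,1)$: $X(s,t)=\left(\frac{u(s)+v(s)(1-t^2)}2,\,-t\,v(s),\,\frac{u(s)-v(s)(1+t^2)}2\right)$, $v>0$. Let $k_{\rm m}$ and $k_{\rm p}$ be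 its principal curvatures along the meridians ($t$ constant) and the parallels ($s$ constant). In class (I)–(III), the planes of the class are the planes orthogonal to $l$: $x_1=c$ for (I) and (II), $x_3=c$ for (III), $c\in\mathbb R$; there are none in class (IV). The non-degenerate quadric surfaces of revolution have the canonical equations below. * Classes (I), (II), (III), with $(\rho,\xi)=(x_3^2-x_2^2,\,x_1)$, $(x_2^2-x_3^2,\,x_1)$, $(x_1^2+x_2^2,\,x_3)$ respectively: Lorentzian ellipsoids $\rho=\alpha^2-\beta^2\xi^2$, one-sheet hyperboloids $\rho=\alpha^2+\beta^2\xi^2$, two-sheets hyperboloids $\rho=-\alpha^2+\beta^2\xi^2$, and paraboloids $\rho=\delta\,\xi$, with $\alpha,\beta,\delta>0$. * Class (IV): $x_1^2+x_2^2-x_3^2=\pm\alpha^2\pm\beta^2(x_1-x_3)^2$ (all four choices of signs), with $\alpha>0$, $\beta\ge 0$. **Theorem.** The only rotational surfaces in $\mathbb L^3$ satisfying $k_{\rm m}=\mu\,k_{\rm p}^3$ with a constant $\mu\neq0$ are the planes and the non-degenerate quadric surfaces of revolution. Precisely: 1. A rotational surface satisfies $k_{\rm m}=\mu\,k_{\rm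 p}^3$ for some $\mu\ne0$ if and only if, up to an isometry of $\mathbb L^3$ that carries the canonical axis of its class onto its own axis, it is contained in one of the planes or quadrics of its class listed above. 2. For each plane or quadric $Q$ of the list there is $\mu\neq0$ such that every point of $Q$ at which the tangent plane is non-degenerate, and at which $\rho>0$ (classes (I)–(III)) or $x_1-x_3\neq0$ (class (IV)), lies on a rotational surface of the same class and with the same axis that is contained in $Q$ and either is spacelike and satisfies $k_{\rm m}=\mu\,k_{\rm p}^3$, or is timelike and satisfies $k_{\rm m}=-\mu\,k_{\rm p}^3$. -/

import Mathlib

open Set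

/-- The underlying vector space of Lorentz-Minkowski 3-space. The canonical coordinates
`x₁, x₂, x₃` of a point `p` are `p 0, p 1, p 2`. -/
abbrev L3 : Type := Fin 3 → ℝ

noncomputable section

namespace L3

/-- The Lorentzian metric `dx₁² + dx₂² - dx₃²`. -/
def form (v w : L3) : ℝ := v 0 * w 0 + v 1 * w 1 - v 2 * w 2

/-- The Lorentzian cross product, characterized by `form (cross v w) x = det (v, w, x)`. -/
def cross (v w : L3) : L3 :=
  ![v 1 * w 2 - v 2 * w 1, v 2 * w 0 - v 0 * w 2, -(v 0 * w 1 - v 1 * w 0)]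

/-- Isometries of Lorentz-Minkowski space: affine bijections whose linear part preserves the
metric. -/
def IsMotion (Φ : L3 ≃ᵃ[ℝ] L3) : Prop :=
  ∀ v w : L3, form (Φ.linear v) (Φ.linear w) = form v w

end L3

/-! ### Local theory of parametrized surfaces `X = X(s, t)` in Lorentz-Minkowski space -/

namespace Patch

variable (X : ℝ → ℝ → L3) (s t : ℝ)

def Xs : L3 := deriv (fun a => X a t) s
def Xt : L3 := deriv (fun b => X s b) t
def Xss : L3 := deriv (fun a => Xs X a t) s
def Xst : L3 := deriv (fun b => Xs X s b) t
def Xtt : L3 := deriv (fun b => Xt X s b) t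

/-- The first fundamental form `!![E, F; F, G]`. -/
def firstForm : Matrix (Fin 2) (Fin 2) ℝ :=
  !![L3.form (Xs X s t) (Xs X s t), L3.form (Xs X s t) (Xt X s t);
     L3.form (Xs X s t) (Xt X s t), L3.form (Xt X s t) (Xt X s t)]

/-- The unit normal `Xs × Xt / √|EG - F²|`. -/
def unitNormal : L3 :=
  (Real.sqrt |(firstForm X s t).det|)⁻¹ • L3.cross (Xs X s t) (Xt X s t)

/-- The second fundamental form `!![e, f; f, g]`, with respect to the unit normal. -/
def secondForm : Matrix (Fin 2) (Fin 2) ℝ :=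
  !![L3.form (Xss X s t) (unitNormal X s t), L3.form (Xst X s t) (unitNormal X s t);
     L3.form (Xst X s t) (unitNormal X s t), L3.form (Xtt X s t) (unitNormal X s t)]

/-- The matrix of the Weingarten endomorphism in the basis `Xs, Xt`. -/
def weingarten : Matrix (Fin 2) (Fin 2) ℝ := (firstForm X s t)⁻¹ * secondForm X s t

/-- `k` is the principal curvature in the direction `w 0 • Xs + w 1 • Xt`, i.e. this direction is
an eigendirection of the Weingarten endomorphism and `k` is its eigenvalue. -/
def IsPrincipalCurvature (w : Fin 2 → ℝ) (k : ℝ) : Prop :=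
  (weingarten X s t).mulVec w = k • w

end Patch

/-! ### Rotational surfaces -/

/-- The classes of rotational surfaces: the axis is spacelike and the generatrix lies in a
Lorentzian plane (`hypFirst`) or in a Euclidean plane (`hypSecond`), the axis is timelike
(`elliptic`), or the axis is lightlike (`parabolic`). -/
inductive RotationKind
  | hypFirst
  | hypSecond
  | elliptic
  | parabolic

namespace RotationKind

/-- Direction of the axis of revolution in canonical position. -/
def axisDir : RotationKind → L3
  | hypFirst => ![1, 0, 0]
  | hypSecond => ![1, 0, 0]
  | elliptic => ![0, 0, 1]
  | parabolic => ![1, 0, 1]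

/-- The axis of revolution in canonical position. -/
def axis (τ : RotationKind) : Set L3 := {p | ∃ c : ℝ, p = c • τ.axisDir}

/-- The one-parameter group of hyperbolic, elliptic or parabolic rotations that fix the
axis in canonical position pointwise. -/
def rotation : RotationKind → ℝ → L3 → L3
  | hypFirst, t, p =>
      ![p 0, p 1 * Real.cosh t + p 2 * Real.sinh t, p 1 * Real.sinh t + p 2 * Real.cosh t]
  | hypSecond, t, p =>
      ![p 0, p 1 * Real.cosh t + p 2 * Real.sinh t, p 1 * Real.sinh t + p 2 * Real.cosh t]
  | elliptic, t, p =>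
      ![p 0 * Real.cos t - p 1 * Real.sin t, p 0 * Real.sin t + p 1 * Real.cos t, p 2]
  | parabolic, t, p =>
      ![(1 - t ^ 2 / 2) * p 0 + t * p 1 + t ^ 2 / 2 * p 2,
        -t * p 0 + p 1 + t * p 2,
        -(t ^ 2 / 2) * p 0 + t * p 1 + (1 + t ^ 2 / 2) * p 2]

/-- The open half-plane bounded by the axis that contains the generatrix curves: `(x, 0, z)` with
`z > 0`, `(x, y, 0)` with `y > 0`, `(x, 0, z)` with `x > 0`, and `(x, 0, z)` with
`v = x - z > 0`, respectively. -/
def halfPlane : RotationKind → Set L3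
  | hypFirst => {p | p 1 = 0 ∧ 0 < p 2}
  | hypSecond => {p | p 2 = 0 ∧ 0 < p 1}
  | elliptic => {p | p 1 = 0 ∧ 0 < p 0}
  | parabolic => {p | p 1 = 0 ∧ 0 < p 0 - p 2}

/-- The square of the (pseudo)distance to the axis (for `hypFirst` and `hypSecond` it is positive
exactly on the part of space swept out by the rotated generatrix half-planes of that class). -/
def sqRadius : RotationKind → L3 → ℝ
  | hypFirst, p => p 2 ^ 2 - p 1 ^ 2
  | hypSecond, p => p 1 ^ 2 - p 2 ^ 2
  | elliptic, p => p 0 ^ 2 + p 1 ^ 2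
  | parabolic, p => (p 0 - p 2) ^ 2

/-- For a spacelike or timelike axis, the coordinate along the axis. (It is used for
non-lightlike axes only; for the lightlike axis this is `u = x₁ + x₃`.) -/
def axialCoord : RotationKind → L3 → ℝ
  | hypFirst, p => p 0
  | hypSecond, p => p 0
  | elliptic, p => p 2
  | parabolic, p => p 0 + p 2

end RotationKind

/-- A non-degenerate rotational surface: the orbit, under the rotations about an axis, of a
spacelike or timelike `C²` curve that lies in an open half-plane (of a non-degenerate plane)
bounded by the axis. The axis is arbitrary: `motion` carries the canonical position to the
actual one. -/
structure RotationalSurface where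
  kind : RotationKind
  motion : L3 ≃ᵃ[ℝ] L3
  isMotion : L3.IsMotion motion
  /-- The interval on which the generatrix is defined. -/
  I : Set ℝ
  I_open : IsOpen I
  I_nonempty : I.Nonempty
  I_connected : I.OrdConnected
  /-- The generatrix, in canonical position. -/
  γ : ℝ → L3
  γ_contDiff : ContDiffOn ℝ 2 γ I
  γ_mem : ∀ s ∈ I, γ s ∈ kind.halfPlane
  γ_nonnull : ∀ s ∈ I, L3.form (deriv γ s) (deriv γ s) ≠ 0

namespace RotationalSurface

/-- The parametrization of the surface; `s` runs along the meridians, `t` along the parallels. -/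
def X (S : RotationalSurface) (s t : ℝ) : L3 := S.motion (S.kind.rotation t (S.γ s))

/-- The surface as a set of points. -/
def carrier (S : RotationalSurface) : Set L3 := {p | ∃ s ∈ S.I, ∃ t : ℝ, p = S.X s t}

/-- The axis of revolution. -/
def axis (S : RotationalSurface) : Set L3 := S.motion '' S.kind.axis

/-- The induced metric is positive definite. -/
def IsSpacelike (S : RotationalSurface) : Prop :=
  ∀ s ∈ S.I, ∀ t : ℝ, (Patch.firstForm S.X s t).PosDef

/-- The induced metric has index one. -/
def IsTimelike (S : RotationalSurface) : Prop :=
  ∀ s ∈ S.I, ∀ t : ℝ, (Patch.firstForm S.X s t).det < 0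

/-- The relation `k_m = μ k_p³` between the principal curvatures along the meridians and
along the parallels, at all points of the surface. -/
def CubicWeingarten (S : RotationalSurface) (μ : ℝ) : Prop :=
  ∀ s ∈ S.I, ∀ t : ℝ, ∃ km kp : ℝ,
    Patch.IsPrincipalCurvature S.X s t ![1, 0] km ∧
    Patch.IsPrincipalCurvature S.X s t ![0, 1] kp ∧
    km = μ * kp ^ 3

end RotationalSurface

/-! ### Planes and non-degenerate quadric surfaces of revolution -/

/-- `IsQuadricOfRevolution τ F`: the equation `F = 0` is one of the canonical equations of the
non-degenerate quadric surfaces of revolution of class `τ`. -/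
inductive IsQuadricOfRevolution : RotationKind → (L3 → ℝ) → Prop
  | ellipsoid (τ : RotationKind) (hτ : τ ≠ .parabolic) (α β : ℝ) (hα : 0 < α) (hβ : 0 < β) :
      IsQuadricOfRevolution τ
        (fun p => τ.sqRadius p - (α ^ 2 - β ^ 2 * τ.axialCoord p ^ 2))
  | oneSheetHyperboloid (τ : RotationKind) (hτ : τ ≠ .parabolic) (α β : ℝ) (hα : 0 < α)
      (hβ : 0 < β) :
      IsQuadricOfRevolution τ
        (fun p => τ.sqRadius p - (α ^ 2 + β ^ 2 * τ.axialCoord p ^ 2))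
  | twoSheetsHyperboloid (τ : RotationKind) (hτ : τ ≠ .parabolic) (α β : ℝ) (hα : 0 < α)
      (hβ : 0 < β) :
      IsQuadricOfRevolution τ
        (fun p => τ.sqRadius p - (-α ^ 2 + β ^ 2 * τ.axialCoord p ^ 2))
  | paraboloid (τ : RotationKind) (hτ : τ ≠ .parabolic) (δ : ℝ) (hδ : 0 < δ) :
      IsQuadricOfRevolution τ (fun p => τ.sqRadius p - δ * τ.axialCoord p)
  | parabolic_a (α β : ℝ) (hα : 0 < α) (hβ : 0 ≤ β) :
      IsQuadricOfRevolution .parabolic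
        (fun p => L3.form p p - (α ^ 2 - β ^ 2 * (p 0 - p 2) ^ 2))
  | parabolic_b (α β : ℝ) (hα : 0 < α) (hβ : 0 ≤ β) :
      IsQuadricOfRevolution .parabolic
        (fun p => L3.form p p - (α ^ 2 + β ^ 2 * (p 0 - p 2) ^ 2))
  | parabolic_c (α β : ℝ) (hα : 0 < α) (hβ : 0 ≤ β) :
      IsQuadricOfRevolution .parabolic
        (fun p => L3.form p p - (-α ^ 2 + β ^ 2 * (p 0 - p 2) ^ 2))
  | parabolic_d (α β : ℝ) (hα : 0 < α) (hβ : 0 ≤ β) :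
      IsQuadricOfRevolution .parabolic
        (fun p => L3.form p p - (-α ^ 2 - β ^ 2 * (p 0 - p 2) ^ 2))

/-- `F = 0` is a (spacelike or timelike) plane orthogonal to the canonical axis of class `τ`.
The planes orthogonal to a lightlike axis are degenerate. -/
def IsPlaneOfRevolution (τ : RotationKind) (F : L3 → ℝ) : Prop :=
  τ ≠ .parabolic ∧ ∃ c : ℝ, F = fun p => τ.axialCoord p - c

/-- The level set of `F` through `p` is regular at `p` with non-degenerate tangent plane: the
Lorentzian gradient of `F` at `p` is neither zero nor lightlike. -/
def NondegenerateAt (F : L3 → ℝ) (p : L3) : Prop :=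
  fderiv ℝ F p (Pi.single 0 1) ^ 2 + fderiv ℝ F p (Pi.single 1 1) ^ 2
    - fderiv ℝ F p (Pi.single 2 1) ^ 2 ≠ 0

end

/-! In the plane of the generatrices use two coordinates: the radius r and the axial coordinate h
(for a lightlike axis these are the null coordinates v and u). All partial derivatives of `X` are
images, under one isometry depending on t, of vectors attached to the generatrix, so both
fundamental forms are diagonal and independent of t up to the sign of the normal. The relation is
odd in the normal, so this sign drops out, and so does the speed of the generatrix
(`cubicWeingarten_iff`). The sign of EG is constant and can be absorbed into the constant.

For a non-lightlike axis there remains (r'' h' - h'' r') r³ = ν h'³ with ν = ±μ. Where h' ≠ 0 this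
is d²r/dh² = ν / r³. Its energy (dr/dh)² + ν / r² = C is conserved, hence r² has constant second
derivative 2C in h, that is r² = C h² + 2 D h + K with D² - C K = -ν (`profile_of_cubic`). The
energy also prevents h' from vanishing somewhere without vanishing everywhere, and h' = 0 everywhere
gives the planes. For a lightlike axis the right side is a multiple of r'³, r is a parameter, and
two integrations give h r = A + C r² + D r with A ≠ 0 (`profile_of_parabolic_cubic`).

Completing the square by a motion along the axis yields the canonical equations. Conversely, a
motion preserving the axis acts on the profile in a controlled way that keeps ν ≠ 0, and
differentiating the profile equation twice recovers the relation. For the second claim, each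
admissible point is moved into the half-plane, and the profile equation is solved there for one
coordinate; non-degeneracy of the tangent plane says exactly that the resulting generatrix is
non-null. -/

noncomputable section

/-! ### Lorentzian algebra: triple product and determinant of an isometry. -/

namespace L3

theorem form_add_left (a b c : L3) : form (a + b) c = form a c + form b c := by
  simp only [form, Pi.add_apply]; ring

theorem form_smul_left (k : ℝ) (a b : L3) : form (k • a) b = k * form a b := by
  simp only [form, Pi.smul_apply, smul_eq_mul]; ring

theorem form_comm (a b : L3) : form a b = form b a := by
  simp only [form]; ring

theorem form_smul_right (k : ℝ) (a b : L3) : form a (k • b) = k * form a b := by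
  rw [form_comm, form_smul_left, form_comm]

/-- The Lorentzian triple product is the determinant. -/
theorem form_cross (v w x : L3) :
    form (cross v w) x = (Pi.basisFun ℝ (Fin 3)).det ![v, w, x] := by
  rw [Pi.basisFun_det]
  change _ = Matrix.det (Matrix.of ![v, w, x])
  rw [Matrix.det_fin_three]
  simp [form, cross]
  ring

/-- For an isometry the factor is ±1 by `det_sq_of_isometry`, so normals are carried to normals up
to sign. -/
theorem form_cross_map (f : L3 →ₗ[ℝ] L3) (v w x : L3) :
    form (cross (f v) (f w)) (f x) = LinearMap.det f * form (cross v w) x := by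
  rw [form_cross, form_cross, ← Module.Basis.det_comp]
  congr 1
  ext i : 1
  fin_cases i <;> rfl

theorem det_sq_of_isometry (f : L3 →ₗ[ℝ] L3) (hf : ∀ v w, form (f v) (f w) = form v w) :
    LinearMap.det f ^ 2 = 1 := by
  let η : Matrix (Fin 3) (Fin 3) ℝ := Matrix.diagonal ![1, 1, -1]
  -- The Gram identity Aᵀ η A = η; its determinant gives det A ² = 1 because det η ≠ 0.
  have key : (LinearMap.toMatrix' f).transpose * η * LinearMap.toMatrix' f = η := by
    ext i j
    have h := hf (Pi.single i 1) (Pi.single j 1)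
    have e1 : ((LinearMap.toMatrix' f).transpose * η * LinearMap.toMatrix' f) i j =
        form (f (Pi.single i 1)) (f (Pi.single j 1)) := by
      simp [η, Matrix.mul_apply, Fin.sum_univ_three, LinearMap.toMatrix'_apply, form,
        Matrix.diagonal_apply]
      ring
    rw [e1, h]
    fin_cases i <;> fin_cases j <;> simp [form, η]
  have h := congrArg Matrix.det key
  rw [Matrix.det_mul, Matrix.det_mul, Matrix.det_transpose, LinearMap.det_toMatrix'] at h
  have hη : η.det = -1 := by simp [η, Matrix.det_diagonal, Fin.prod_univ_three]
  rw [hη] at h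
  linarith

end L3

/-! ### Rotations, their generator, and the plane of the generatrices. -/

namespace RotationKind

/-- The (pseudo)distance to the axis as a linear function on the plane of the generatrices. -/
def radius : RotationKind → L3 → ℝ
  | hypFirst, p => p 2
  | hypSecond, p => p 1
  | elliptic, p => p 0
  | parabolic, p => p 0 - p 2

/-- The plane of the generatrices in canonical position. -/
def plane : RotationKind → Set L3
  | hypFirst => {p | p 1 = 0}
  | hypSecond => {p | p 2 = 0}
  | elliptic => {p | p 1 = 0}
  | parabolic => {p | p 1 = 0}

/-- The rotation of parameter `t` as a linear map. -/
def rotationLin (τ : RotationKind) (t : ℝ) : L3 →ₗ[ℝ] L3 where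
  toFun := τ.rotation t
  map_add' p q := by
    cases τ <;> ext i <;> fin_cases i <;> simp [rotation] <;> ring
  map_smul' c p := by
    cases τ <;> ext i <;> fin_cases i <;> simp [rotation] <;> ring

@[simp] theorem rotationLin_apply (τ : RotationKind) (t : ℝ) (p : L3) :
    τ.rotationLin t p = τ.rotation t p := rfl

theorem form_rotation (τ : RotationKind) (t : ℝ) (p q : L3) :
    L3.form (τ.rotation t p) (τ.rotation t q) = L3.form p q := by
  have h1 := Real.cosh_sq t
  have h2 := Real.sin_sq_add_cos_sq t
  cases τ
  · simp [rotation, L3.form]; linear_combination (p 1 * q 1 - p 2 * q 2) * h1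
  · simp [rotation, L3.form]; linear_combination (p 1 * q 1 - p 2 * q 2) * h1
  · simp [rotation, L3.form]; linear_combination (p 0 * q 0 + p 1 * q 1) * h2
  · simp [rotation, L3.form]; ring

/-- The infinitesimal generator of the group of rotations. -/
def generator : RotationKind → L3 → L3
  | hypFirst, p => ![0, p 2, p 1]
  | hypSecond, p => ![0, p 2, p 1]
  | elliptic, p => ![-p 1, p 0, 0]
  | parabolic, p => ![p 1, p 2 - p 0, p 1]

/-- One-parameter group law: differentiation in t inserts the generator before the rotation, so the
isometry can be pulled out of every derivative of `X`. -/
theorem hasDerivAt_rotation (τ : RotationKind) (t : ℝ) (p : L3) :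
    HasDerivAt (fun b => τ.rotation b p) (τ.rotation t (τ.generator p)) t := by
  rw [hasDerivAt_pi]
  have hc := Real.hasDerivAt_cosh t
  have hs := Real.hasDerivAt_sinh t
  have hc' := Real.hasDerivAt_cos t
  have hs' := Real.hasDerivAt_sin t
  have hi := hasDerivAt_id t
  have hq := (hasDerivAt_pow 2 t).div_const 2
  intro i
  cases τ <;> fin_cases i <;> simp only [rotation, generator, Matrix.cons_val, Fin.zero_eta,
    Fin.mk_one, Fin.reduceFinMk]
  · exact hasDerivAt_const t _
  · exact ((hc.const_mul (p 1)).add (hs.const_mul (p 2))).congr_deriv (by ring)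
  · exact ((hs.const_mul (p 1)).add (hc.const_mul (p 2))).congr_deriv (by ring)
  · exact hasDerivAt_const t _
  · exact ((hc.const_mul (p 1)).add (hs.const_mul (p 2))).congr_deriv (by ring)
  · exact ((hs.const_mul (p 1)).add (hc.const_mul (p 2))).congr_deriv (by ring)
  · exact ((hc'.const_mul (p 0)).sub (hs'.const_mul (p 1))).congr_deriv (by ring)
  · exact ((hs'.const_mul (p 0)).add (hc'.const_mul (p 1))).congr_deriv (by ring)
  · exact hasDerivAt_const t _
  · exact ((((hq.const_sub 1).mul_const (p 0)).add (hi.mul_const (p 1))).add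
      (hq.mul_const (p 2))).congr_deriv (by push_cast; ring)
  · exact (((hi.neg.mul_const (p 0)).add_const (p 1)).add
      (hi.mul_const (p 2))).congr_deriv (by ring)
  · exact (((hq.neg.mul_const (p 0)).add (hi.mul_const (p 1))).add
      ((hq.const_add 1).mul_const (p 2))).congr_deriv (by push_cast; ring)

/-- The causal character of the parallels. -/
def parallelSign : RotationKind → ℝ
  | hypSecond => -1
  | _ => 1

/-- Up to normalization, the curvature of a meridian with velocity `v` and acceleration `a`. -/
def meridianBend : RotationKind → L3 → L3 → ℝ
  | hypFirst, v, a => a 2 * v 0 - a 0 * v 2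
  | hypSecond, v, a => a 1 * v 0 - a 0 * v 1
  | elliptic, v, a => -(a 0 * v 2 - a 2 * v 0)
  | parabolic, v, a => ((a 0 - a 2) * (v 0 + v 2) - (a 0 + a 2) * (v 0 - v 2)) / 2

/-- Up to normalization, the curvature of a parallel of a surface with meridian velocity `v`. -/
def parallelBend : RotationKind → L3 → ℝ
  | hypFirst, v => v 0
  | hypSecond, v => v 0
  | elliptic, v => v 2
  | parabolic, v => v 0 - v 2

theorem parallelSign_sq (τ : RotationKind) : τ.parallelSign ^ 2 = 1 := by
  cases τ <;> simp [parallelSign]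

section
variable {τ : RotationKind} {p v a : L3}

theorem form_velocity_generator (hp : p ∈ τ.plane) (hv : v ∈ τ.plane) :
    L3.form v (τ.generator p) = 0 := by
  cases τ <;> simp only [plane, mem_ofPred_eq] at hp hv <;> simp [L3.form, generator, hp, hv]

theorem form_generator (hp : p ∈ τ.plane) :
    L3.form (τ.generator p) (τ.generator p) = τ.parallelSign * τ.radius p ^ 2 := by
  cases τ <;> simp only [plane, mem_ofPred_eq] at hp <;>
    simp [L3.form, generator, hp, parallelSign, radius] <;> ring

theorem triple_acceleration (hp : p ∈ τ.plane) (hv : v ∈ τ.plane) :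
    L3.form (L3.cross v (τ.generator p)) a =
      τ.parallelSign * τ.radius p * τ.meridianBend v a := by
  cases τ <;> simp only [plane, mem_ofPred_eq] at hp hv <;>
    simp [L3.form, L3.cross, generator, hp, hv, parallelSign, radius, meridianBend] <;> ring

/-- Together with `form_velocity_generator` this makes both fundamental forms diagonal: meridians
and parallels are lines of curvature. -/
theorem triple_mixed (hp : p ∈ τ.plane) (hv : v ∈ τ.plane) :
    L3.form (L3.cross v (τ.generator p)) (τ.generator v) = 0 := by
  cases τ <;> simp only [plane, mem_ofPred_eq] at hp hv <;>
    simp [L3.form, L3.cross, generator, hp, hv]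

theorem triple_parallel (hp : p ∈ τ.plane) (hv : v ∈ τ.plane) :
    L3.form (L3.cross v (τ.generator p)) (τ.generator (τ.generator p)) =
      τ.parallelSign * τ.radius p ^ 2 * τ.parallelBend v := by
  cases τ <;> simp only [plane, mem_ofPred_eq] at hp hv <;>
    simp [L3.form, L3.cross, generator, hp, hv, parallelSign, radius, parallelBend] <;> ring

theorem mem_plane_of_mem_halfPlane (hp : p ∈ τ.halfPlane) : p ∈ τ.plane := by
  cases τ <;> exact hp.1

theorem radius_pos_of_mem_halfPlane (hp : p ∈ τ.halfPlane) : 0 < τ.radius p := by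
  cases τ <;> exact hp.2

end

/-- A differentiable curve in the plane of the generatrices has its velocity in that plane. -/
theorem deriv_mem_plane (τ : RotationKind) {γ : ℝ → L3} {s : ℝ} {v : L3}
    (hγ : HasDerivAt γ v s) (h : ∀ᶠ a in nhds s, γ a ∈ τ.plane) : v ∈ τ.plane := by
  rw [hasDerivAt_pi] at hγ
  have key : ∀ i, (∀ᶠ a in nhds s, γ a i = 0) → v i = 0 := fun i hi =>
    (hγ i).unique ((hasDerivAt_const s (0 : ℝ)).congr_of_eventuallyEq hi)
  cases τ <;> exact key _ h

end RotationKind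

/-! ### Fundamental forms of a rotational surface and reduction to the generatrix. -/

theorem L3.motion_apply (M : L3 ≃ᵃ[ℝ] L3) (p : L3) : M p = M.linear p + M 0 := by
  simpa using M.map_vadd 0 p

theorem L3.hasDerivAt_motion {c : ℝ → L3} {v : L3} {s : ℝ} (M : L3 ≃ᵃ[ℝ] L3)
    (hc : HasDerivAt c v s) : HasDerivAt (fun a => M (c a)) (M.linear v) s := by
  have h1 : (fun a => M (c a)) = fun a => M.linear (c a) + M 0 := by
    funext a
    exact L3.motion_apply M (c a)
  rw [h1]
  exact ((LinearMap.toContinuousLinearMap (M.linear : L3 →ₗ[ℝ] L3)).hasFDerivAt.comp_hasDerivAt s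
    hc).add_const _

theorem L3.hasDerivAt_linear {c : ℝ → L3} {v : L3} {s : ℝ} (M : L3 →ₗ[ℝ] L3)
    (hc : HasDerivAt c v s) : HasDerivAt (fun a => M (c a)) (M v) s :=
  (LinearMap.toContinuousLinearMap M).hasFDerivAt.comp_hasDerivAt s hc

namespace RotationalSurface
variable (S : RotationalSurface)

/-- The linear part of the motion that carries the generatrix to the meridian of parameter `t`. -/
def frame (t : ℝ) : L3 →ₗ[ℝ] L3 := (S.motion.linear : L3 →ₗ[ℝ] L3) ∘ₗ S.kind.rotationLin t

theorem form_frame (t : ℝ) (v w : L3) : L3.form (S.frame t v) (S.frame t w) = L3.form v w := by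
  simp [frame, S.isMotion _ _, S.kind.form_rotation]

section
variable {S} {s : ℝ}

theorem hasDerivAt_γ (hs : s ∈ S.I) : HasDerivAt S.γ (deriv S.γ s) s :=
  ((S.γ_contDiff.differentiableOn (by norm_num)).differentiableAt
    (S.I_open.mem_nhds hs)).hasDerivAt

theorem contDiffOn_deriv_γ : ContDiffOn ℝ 1 (deriv S.γ) S.I :=
  ((contDiffOn_succ_iff_deriv_of_isOpen (n := 1) S.I_open).1 S.γ_contDiff).2.2

theorem hasDerivAt_deriv_γ (hs : s ∈ S.I) :
    HasDerivAt (deriv S.γ) (deriv (deriv S.γ) s) s :=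
  ((contDiffOn_deriv_γ.differentiableOn (by norm_num)).differentiableAt
    (S.I_open.mem_nhds hs)).hasDerivAt

theorem γ_mem_plane (hs : s ∈ S.I) : S.γ s ∈ S.kind.plane :=
  RotationKind.mem_plane_of_mem_halfPlane (S.γ_mem s hs)

theorem velocity_mem_plane (hs : s ∈ S.I) : deriv S.γ s ∈ S.kind.plane :=
  S.kind.deriv_mem_plane (hasDerivAt_γ hs)
    (Filter.mem_of_superset (S.I_open.mem_nhds hs) fun _ => γ_mem_plane)

theorem Xs_eq (hs : s ∈ S.I) (t : ℝ) : Patch.Xs S.X s t = S.frame t (deriv S.γ s) :=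
  (L3.hasDerivAt_motion S.motion
    (L3.hasDerivAt_linear (S.kind.rotationLin t) (hasDerivAt_γ hs))).deriv

theorem Xt_eq (s t : ℝ) :
    Patch.Xt S.X s t = S.frame t (S.kind.generator (S.γ s)) :=
  (L3.hasDerivAt_motion S.motion (S.kind.hasDerivAt_rotation t (S.γ s))).deriv

theorem Xss_eq (hs : s ∈ S.I) (t : ℝ) :
    Patch.Xss S.X s t = S.frame t (deriv (deriv S.γ) s) :=
  ((L3.hasDerivAt_linear (S.frame t) (hasDerivAt_deriv_γ hs)).congr_of_eventuallyEq
    (Filter.mem_of_superset (S.I_open.mem_nhds hs) fun _ ha => Xs_eq ha t)).deriv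

theorem Xst_eq (hs : s ∈ S.I) (t : ℝ) :
    Patch.Xst S.X s t = S.frame t (S.kind.generator (deriv S.γ s)) := by
  have h : (fun b => Patch.Xs S.X s b) = fun b => S.frame b (deriv S.γ s) :=
    funext fun b => Xs_eq hs b
  rw [Patch.Xst, h]
  exact (L3.hasDerivAt_linear (S.motion.linear : L3 →ₗ[ℝ] L3)
    (S.kind.hasDerivAt_rotation t (deriv S.γ s))).deriv

theorem Xtt_eq (s t : ℝ) :
    Patch.Xtt S.X s t = S.frame t (S.kind.generator (S.kind.generator (S.γ s))) := by
  have h : (fun b => Patch.Xt S.X s b) = fun b => S.frame b (S.kind.generator (S.γ s)) :=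
    funext fun b => Xt_eq s b
  rw [Patch.Xtt, h]
  exact (L3.hasDerivAt_linear (S.motion.linear : L3 →ₗ[ℝ] L3)
    (S.kind.hasDerivAt_rotation t _)).deriv

theorem firstForm_eq (hs : s ∈ S.I) (t : ℝ) :
    Patch.firstForm S.X s t = !![L3.form (deriv S.γ s) (deriv S.γ s), 0;
      0, S.kind.parallelSign * S.kind.radius (S.γ s) ^ 2] := by
  rw [Patch.firstForm, Xs_eq hs, Xt_eq]
  simp only [form_frame, RotationKind.form_velocity_generator (γ_mem_plane hs)
    (velocity_mem_plane hs), RotationKind.form_generator (γ_mem_plane hs)]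

/-- The sign δ is the determinant of the frame; it depends on the orientation behaviour of the
motion and need not be computed. -/
theorem secondForm_eq (hs : s ∈ S.I) (t : ℝ) :
    ∃ δ : ℝ, δ ^ 2 = 1 ∧ Patch.secondForm S.X s t =
      (δ * (Real.sqrt |(Patch.firstForm S.X s t).det|)⁻¹ * S.kind.parallelSign) •
        !![S.kind.radius (S.γ s) * S.kind.meridianBend (deriv S.γ s) (deriv (deriv S.γ) s), 0;
          0, S.kind.radius (S.γ s) ^ 2 * S.kind.parallelBend (deriv S.γ s)] := by
  refine ⟨LinearMap.det (S.frame t), L3.det_sq_of_isometry _ (S.form_frame t), ?_⟩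
  have hp := γ_mem_plane hs
  have hv := velocity_mem_plane hs
  rw [Patch.secondForm, Patch.unitNormal, Xs_eq hs, Xt_eq, Xss_eq hs, Xst_eq hs, Xtt_eq]
  simp only [L3.form_smul_right, L3.form_comm _ (L3.cross _ _), L3.form_cross_map,
    RotationKind.triple_acceleration (a := deriv (deriv S.γ) s) hp hv, RotationKind.triple_mixed hp hv,
    RotationKind.triple_parallel hp hv]
  ext i j
  fin_cases i <;> fin_cases j <;> simp <;> ring

/-- The cubic Weingarten relation in terms of the generatrix. -/
theorem cubicWeingarten_iff (μ : ℝ) :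
    S.CubicWeingarten μ ↔ ∀ s ∈ S.I,
      S.kind.meridianBend (deriv S.γ s) (deriv (deriv S.γ) s) * S.kind.radius (S.γ s) ^ 3 *
        (S.kind.parallelSign * L3.form (deriv S.γ s) (deriv S.γ s)) =
      μ * S.kind.parallelBend (deriv S.γ s) ^ 3 * |L3.form (deriv S.γ s) (deriv S.γ s)| := by
  have key : ∀ s ∈ S.I, ∀ t : ℝ, (∃ km kp : ℝ,
      Patch.IsPrincipalCurvature S.X s t ![1, 0] km ∧
      Patch.IsPrincipalCurvature S.X s t ![0, 1] kp ∧ km = μ * kp ^ 3) ↔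
      S.kind.meridianBend (deriv S.γ s) (deriv (deriv S.γ) s) * S.kind.radius (S.γ s) ^ 3 *
        (S.kind.parallelSign * L3.form (deriv S.γ s) (deriv S.γ s)) =
      μ * S.kind.parallelBend (deriv S.γ s) ^ 3 * |L3.form (deriv S.γ s) (deriv S.γ s)| := by
    intro s hs t
    obtain ⟨δ, hδ, h2⟩ := secondForm_eq hs t
    have h1 := firstForm_eq hs t
    have hE := S.γ_nonnull s hs
    have hr := RotationKind.radius_pos_of_mem_halfPlane (S.γ_mem s hs)
    have hc := S.kind.parallelSign_sq
    set E := L3.form (deriv S.γ s) (deriv S.γ s)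
    set r := S.kind.radius (S.γ s)
    set c := S.kind.parallelSign
    set m := S.kind.meridianBend (deriv S.γ s) (deriv (deriv S.γ) s)
    set n := S.kind.parallelBend (deriv S.γ s)
    have hc0 : c ≠ 0 := by rintro h; simp [h] at hc
    have hδ0 : δ ≠ 0 := by rintro h; simp [h] at hδ
    have hdet : (Patch.firstForm S.X s t).det = E * (c * r ^ 2) := by
      rw [h1, Matrix.det_fin_two_of]; ring
    have habs : |E * (c * r ^ 2)| = |E| * r ^ 2 := by
      have : |c| = 1 := by
        rw [← sq_eq_sq₀ (abs_nonneg c) one_pos.le, sq_abs]; simpa using hc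
      rw [abs_mul, abs_mul, this, abs_of_pos (by positivity : 0 < r ^ 2), one_mul]
    rw [hdet, habs] at h2
    have hA : 0 < |E| := abs_pos.2 hE
    have hAA : |E| * |E| = E * E := abs_mul_abs_self E
    set A := |E|
    set q := Real.sqrt (A * r ^ 2)
    have hq : q ^ 2 = A * r ^ 2 := Real.sq_sqrt (by positivity)
    have hq0 : q ≠ 0 := (Real.sqrt_pos.2 (by positivity)).ne'
    have hinv : (Patch.firstForm S.X s t)⁻¹ = !![E⁻¹, 0; 0, (c * r ^ 2)⁻¹] := by
      rw [h1]
      apply Matrix.inv_eq_right_inv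
      ext i j
      fin_cases i <;> fin_cases j <;> simp [Matrix.mul_apply, hE]
      field_simp
    have hW : Patch.weingarten S.X s t =
        !![E⁻¹ * (δ * q⁻¹ * c * (r * m)), 0; 0, (c * r ^ 2)⁻¹ * (δ * q⁻¹ * c * (r ^ 2 * n))] := by
      rw [Patch.weingarten, hinv, h2]
      ext i j
      fin_cases i <;> fin_cases j <;> simp [Matrix.mul_apply]
    have hm : ∀ k, Patch.IsPrincipalCurvature S.X s t ![1, 0] k ↔
        k = E⁻¹ * (δ * q⁻¹ * c * (r * m)) := by
      intro k
      rw [Patch.IsPrincipalCurvature, hW, funext_iff, Fin.forall_fin_two]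
      simp [Matrix.mulVec, dotProduct, eq_comm]
    have hp : ∀ k, Patch.IsPrincipalCurvature S.X s t ![0, 1] k ↔
        k = (c * r ^ 2)⁻¹ * (δ * q⁻¹ * c * (r ^ 2 * n)) := by
      intro k
      rw [Patch.IsPrincipalCurvature, hW, funext_iff, Fin.forall_fin_two]
      simp [Matrix.mulVec, dotProduct, eq_comm]
    simp only [hm, hp, exists_and_left, exists_eq_left]
    -- With q = r √|E| the curvatures are k_m = δ c m / (E √|E|) and k_p = δ n / q. Both sides are
    -- brought to the denominator A² q³, and δ³ = δ lets the unknown sign cancel.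
    have e1 : E⁻¹ * (δ * q⁻¹ * c * (r * m)) = δ * (c * E * m * r ^ 3 * A / (A ^ 2 * (q * q ^ 2))) := by
      rw [hq]; field_simp; linear_combination m * hAA
    have e2 : μ * ((c * r ^ 2)⁻¹ * (δ * q⁻¹ * c * (r ^ 2 * n))) ^ 3 =
        δ * (μ * n ^ 3 * A * A / (A ^ 2 * (q * q ^ 2))) := by
      field_simp
      rw [hδ]; ring
    rw [e1, e2, mul_right_inj' hδ0, div_left_inj' (by positivity)]
    rw [mul_left_inj' hA.ne']
    constructor <;> intro h <;> linear_combination h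
  constructor
  · intro h s hs
    exact (key s hs 0).1 (h s hs 0)
  · intro h s hs t
    exact (key s hs t).2 (h s hs)

end
end RotationalSurface

/-! ### The differential equations of the profile curve. -/

theorem eq_const_of_hasDerivAt_zero {I : Set ℝ} (hI : IsOpen I) (hc : IsPreconnected I)
    {f : ℝ → ℝ} (hf : ∀ s ∈ I, HasDerivAt f 0 s) : ∃ c, ∀ s ∈ I, f s = c := by
  rcases I.eq_empty_or_nonempty with rfl | ⟨a, ha⟩
  · exact ⟨0, by simp⟩
  · exact ⟨f a, fun s hs => hI.is_const_of_deriv_eq_zero hc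
      (fun x hx => (hf x hx).differentiableAt.differentiableWithinAt)
      (fun x hx => (hf x hx).deriv) hs ha⟩

section
variable {I : Set ℝ} {r r1 r2 h h1 h2 : ℝ → ℝ}

theorem hasDerivAt_slope {s : ℝ} (hr1 : HasDerivAt r1 (r2 s) s) (hh1 : HasDerivAt h1 (h2 s) s)
    (hn : h1 s ≠ 0) :
    HasDerivAt (fun s => r1 s / h1 s) ((r2 s * h1 s - r1 s * h2 s) / h1 s ^ 2) s :=
  hr1.fun_div hh1 hn

/-- First integral of `(r'' h' - h'' r') r³ = ν h'³` where `h' ≠ 0`. -/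
theorem slope_sq_of_cubic {ν : ℝ} (hI : IsOpen I) (hc : IsPreconnected I)
    (hr : ∀ s ∈ I, HasDerivAt r (r1 s) s) (hr1 : ∀ s ∈ I, HasDerivAt r1 (r2 s) s)
    (hh1 : ∀ s ∈ I, HasDerivAt h1 (h2 s) s)
    (pos : ∀ s ∈ I, 0 < r s) (hn : ∀ s ∈ I, h1 s ≠ 0)
    (eq : ∀ s ∈ I, (r2 s * h1 s - h2 s * r1 s) * r s ^ 3 = ν * h1 s ^ 3) :
    ∃ C, ∀ s ∈ I, r1 s ^ 2 * r s ^ 2 = h1 s ^ 2 * (C * r s ^ 2 - ν) := by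
  -- Conservation of energy for d²r/dh² = ν / r³.
  have key : ∀ s ∈ I, HasDerivAt (fun s => (r1 s / h1 s) ^ 2 + ν / r s ^ 2) 0 s := by
    intro s hs
    have n1 := hn s hs
    have n2 := (pos s hs).ne'
    have d1 := (hasDerivAt_slope (hr1 s hs) (hh1 s hs) n1).fun_pow 2
    have d2 := (hasDerivAt_const s ν).fun_div ((hr s hs).fun_pow 2) (pow_ne_zero 2 n2)
    refine (d1.add d2).congr_deriv ?_
    have e : r2 s * h1 s - r1 s * h2 s = ν * h1 s ^ 3 / r s ^ 3 := by
      field_simp; linear_combination eq s hs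
    rw [e]
    simp only [Nat.add_one_sub_one, pow_one, Nat.cast_ofNat]
    field_simp
    ring
  obtain ⟨C, hC⟩ := eq_const_of_hasDerivAt_zero hI hc key
  refine ⟨C, fun s hs => ?_⟩
  have n1 := hn s hs
  have n2 := (pos s hs).ne'
  have e := hC s hs
  field_simp at e
  linear_combination e

/-- With h as parameter, half the second derivative of r² is (dr/dh)² + r d²r/dh² = (C - ν / r²) + ν
/ r² = C. So r² is a quadratic polynomial in h, whose coefficients appear as the successive
constants of integration. -/
theorem profile_of_cubic_of_ne {ν : ℝ} (hI : IsOpen I) (hc : IsPreconnected I)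
    (hne : I.Nonempty)
    (hr : ∀ s ∈ I, HasDerivAt r (r1 s) s) (hr1 : ∀ s ∈ I, HasDerivAt r1 (r2 s) s)
    (hh : ∀ s ∈ I, HasDerivAt h (h1 s) s) (hh1 : ∀ s ∈ I, HasDerivAt h1 (h2 s) s)
    (pos : ∀ s ∈ I, 0 < r s) (hn : ∀ s ∈ I, h1 s ≠ 0)
    (eq : ∀ s ∈ I, (r2 s * h1 s - h2 s * r1 s) * r s ^ 3 = ν * h1 s ^ 3) :
    ∃ C D K, D ^ 2 - C * K = -ν ∧ ∀ s ∈ I, r s ^ 2 = C * h s ^ 2 + 2 * D * h s + K := by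
  obtain ⟨C, hC⟩ := slope_sq_of_cubic hI hc hr hr1 hh1 pos hn eq
  have k1 : ∀ s ∈ I, HasDerivAt (fun s => r s * (r1 s / h1 s) - C * h s) 0 s := by
    intro s hs
    have n1 := hn s hs
    have n2 := (pos s hs).ne'
    refine (((hr s hs).mul (hasDerivAt_slope (hr1 s hs) (hh1 s hs) n1)).sub
      ((hh s hs).const_mul C)).congr_deriv ?_
    have e := eq s hs
    have e' := hC s hs
    have : (r1 s ^ 2 * h1 s + r s * (r2 s * h1 s - r1 s * h2 s) - C * h1 s ^ 3) * r s ^ 2 = 0 := by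
      linear_combination e + h1 s * e'
    have := (mul_eq_zero.1 this).resolve_right (pow_ne_zero 2 n2)
    field_simp
    linear_combination this
  obtain ⟨D, hD⟩ := eq_const_of_hasDerivAt_zero hI hc k1
  have hD' : ∀ s ∈ I, r s * r1 s = (C * h s + D) * h1 s := by
    intro s hs
    have n1 := hn s hs
    have e := hD s hs
    field_simp at e
    linear_combination e
  have k2 : ∀ s ∈ I, HasDerivAt (fun s => r s ^ 2 - (C * h s ^ 2 + 2 * D * h s)) 0 s := by
    intro s hs
    refine (((hr s hs).fun_pow 2).sub ((((hh s hs).fun_pow 2).const_mul C).add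
      ((hh s hs).const_mul (2 * D)))).congr_deriv ?_
    push_cast
    linear_combination 2 * hD' s hs
  obtain ⟨K, hK⟩ := eq_const_of_hasDerivAt_zero hI hc k2
  refine ⟨C, D, K, ?_, fun s hs => by linear_combination hK s hs⟩
  -- The energy at a single point ties the discriminant to ν.
  obtain ⟨s, hs⟩ := hne
  have n1 := hn s hs
  have e1 := hC s hs
  have e2 := hD' s hs
  have e3 := hK s hs
  have : h1 s ^ 2 * (D ^ 2 - C * K + ν) = 0 := by
    linear_combination e1 - (r s * r1 s + (C * h s + D) * h1 s) * e2 + C * h1 s ^ 2 * e3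
  have := (mul_eq_zero.1 this).resolve_left (pow_ne_zero 2 n1)
  linarith

/-- Along a regular solution of `(r'' h' - h'' r') r³ = ν h'³`, either `h'` vanishes identically
or it never vanishes. -/
theorem forall_ne_zero_of_cubic {ν : ℝ} (hI : IsOpen I) (hc : IsPreconnected I)
    (hr : ∀ s ∈ I, HasDerivAt r (r1 s) s) (hr1 : ∀ s ∈ I, HasDerivAt r1 (r2 s) s)
    (hh1 : ∀ s ∈ I, HasDerivAt h1 (h2 s) s)
    (pos : ∀ s ∈ I, 0 < r s) (reg : ∀ s ∈ I, h1 s = 0 → r1 s ≠ 0)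
    (eq : ∀ s ∈ I, (r2 s * h1 s - h2 s * r1 s) * r s ^ 3 = ν * h1 s ^ 3)
    {b : ℝ} (hb : b ∈ I) (hb1 : h1 b ≠ 0) : ∀ s ∈ I, h1 s ≠ 0 := by
  have ch1 : ContinuousOn h1 I := fun s hs => (hh1 s hs).continuousAt.continuousWithinAt
  have cr1 : ContinuousOn r1 I := fun s hs => (hr1 s hs).continuousAt.continuousWithinAt
  have cr : ContinuousOn r I := fun s hs => (hr s hs).continuousAt.continuousWithinAt
  set U : Set ℝ := {s ∈ I | h1 s ≠ 0} with hU
  have hUo : IsOpen U := ch1.isOpen_inter_preimage hI isOpen_ne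
  set J := connectedComponentIn U b with hJ
  have hbU : b ∈ U := ⟨hb, hb1⟩
  have hJU : J ⊆ U := connectedComponentIn_subset U b
  have hJo : IsOpen J := hUo.connectedComponentIn
  have hJc : IsPreconnected J := isPreconnected_connectedComponentIn
  have hbJ : b ∈ J := mem_connectedComponentIn hbU
  have hJI : ∀ s ∈ J, s ∈ I := fun s hs => (hJU hs).1
  obtain ⟨C, hC⟩ := slope_sq_of_cubic hJo hJc (fun s hs => hr s (hJI s hs))
    (fun s hs => hr1 s (hJI s hs)) (fun s hs => hh1 s (hJI s hs)) (fun s hs => pos s (hJI s hs))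
    (fun s hs => (hJU hs).2) (fun s hs => eq s (hJI s hs))
  -- The first integral extends by continuity to limit points of J in I. There h' = 0 would force r'
  -- r = 0, against regularity and r > 0, so the limit point still belongs to the component J. Thus
  -- J is relatively closed as well as open in I.
  have hcl : closure J ∩ I ⊆ J := by
    rintro x ⟨hx, hxI⟩
    have hxe : r1 x ^ 2 * r x ^ 2 = h1 x ^ 2 * (C * r x ^ 2 - ν) := by
      have hlim : (nhdsWithin x J).NeBot := mem_closure_iff_nhdsWithin_neBot.1 hx
      have tr := ((hr x hxI).continuousAt.tendsto.mono_left nhdsWithin_le_nhds :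
        Filter.Tendsto r (nhdsWithin x J) _)
      have tr1 := ((hr1 x hxI).continuousAt.tendsto.mono_left nhdsWithin_le_nhds :
        Filter.Tendsto r1 (nhdsWithin x J) _)
      have th1 := ((hh1 x hxI).continuousAt.tendsto.mono_left nhdsWithin_le_nhds :
        Filter.Tendsto h1 (nhdsWithin x J) _)
      refine tendsto_nhds_unique_of_eventuallyEq ((tr1.pow 2).mul (tr.pow 2))
        ((th1.pow 2).mul (((tr.pow 2).const_mul C).sub_const ν)) ?_
      filter_upwards [self_mem_nhdsWithin] with s hs using hC s hs
    have hxU : x ∈ U := by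
      refine ⟨hxI, fun h0 => ?_⟩
      have : r1 x ^ 2 * r x ^ 2 = 0 := by rw [hxe, h0]; ring
      rcases mul_eq_zero.1 this with h' | h'
      · exact reg x hxI h0 (pow_eq_zero_iff two_ne_zero |>.1 h')
      · exact (pos x hxI).ne' (pow_eq_zero_iff two_ne_zero |>.1 h')
    have hpre : IsPreconnected (insert x J) :=
      hJc.subset_closure (subset_insert x J) (insert_subset hx subset_closure)
    exact hpre.subset_connectedComponentIn (mem_insert_of_mem x hbJ)
      (insert_subset hxU hJU) (mem_insert x J)
  have := hc.subset_of_closure_inter_subset hJo ⟨b, hb, hbJ⟩ hcl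
  exact fun s hs => (hJU (this hs)).2

theorem profile_of_cubic {ν : ℝ} (hI : IsOpen I) (hc : IsPreconnected I) (hne : I.Nonempty)
    (hr : ∀ s ∈ I, HasDerivAt r (r1 s) s) (hr1 : ∀ s ∈ I, HasDerivAt r1 (r2 s) s)
    (hh : ∀ s ∈ I, HasDerivAt h (h1 s) s) (hh1 : ∀ s ∈ I, HasDerivAt h1 (h2 s) s)
    (pos : ∀ s ∈ I, 0 < r s) (reg : ∀ s ∈ I, h1 s = 0 → r1 s ≠ 0)
    (eq : ∀ s ∈ I, (r2 s * h1 s - h2 s * r1 s) * r s ^ 3 = ν * h1 s ^ 3) :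
    (∃ c, ∀ s ∈ I, h s = c) ∨
    ∃ C D K, D ^ 2 - C * K = -ν ∧ ∀ s ∈ I, r s ^ 2 = C * h s ^ 2 + 2 * D * h s + K := by
  by_cases H : ∃ b ∈ I, h1 b ≠ 0
  · obtain ⟨b, hb, hb1⟩ := H
    exact Or.inr (profile_of_cubic_of_ne hI hc hne hr hr1 hh hh1 pos
      (forall_ne_zero_of_cubic hI hc hr hr1 hh1 pos reg eq hb hb1) eq)
  · push Not at H
    exact Or.inl (eq_const_of_hasDerivAt_zero hI hc fun s hs => H s hs ▸ hh s hs)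

/-- The first two derivatives of an identity on an open set. -/
theorem hasDerivAt_unique_on {f g f' g' : ℝ → ℝ} (hI : IsOpen I)
    (hf : ∀ s ∈ I, HasDerivAt f (f' s) s) (hg : ∀ s ∈ I, HasDerivAt g (g' s) s)
    (h : ∀ s ∈ I, f s = g s) : ∀ s ∈ I, f' s = g' s := fun s hs =>
  (hf s hs).unique ((hg s hs).congr_of_eventuallyEq
    (Filter.mem_of_superset (hI.mem_nhds hs) fun a ha => h a ha))

/-- Two differentiations of the profile equation; nothing is divided by h', so its zeros do no harm.
-/
theorem cubic_of_profile {C D K : ℝ} (hI : IsOpen I)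
    (hr : ∀ s ∈ I, HasDerivAt r (r1 s) s) (hr1 : ∀ s ∈ I, HasDerivAt r1 (r2 s) s)
    (hh : ∀ s ∈ I, HasDerivAt h (h1 s) s) (hh1 : ∀ s ∈ I, HasDerivAt h1 (h2 s) s)
    (eq : ∀ s ∈ I, r s ^ 2 = C * h s ^ 2 + 2 * D * h s + K) :
    ∀ s ∈ I, (r2 s * h1 s - h2 s * r1 s) * r s ^ 3 = (C * K - D ^ 2) * h1 s ^ 3 := by
  have e1 : ∀ s ∈ I, r s * r1 s = (C * h s + D) * h1 s := by
    intro s hs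
    have := hasDerivAt_unique_on hI (fun s hs => (hr s hs).fun_pow 2)
      (fun s hs => ((((hh s hs).fun_pow 2).const_mul C).add
        ((hh s hs).const_mul (2 * D))).add_const K) eq s hs
    push_cast at this
    linear_combination this / 2
  have e2 := hasDerivAt_unique_on hI (fun s hs => (hr s hs).mul (hr1 s hs))
    (fun s hs => (((hh s hs).const_mul C).add_const D).mul (hh1 s hs)) e1
  intro s hs
  have a0 := eq s hs
  have a1 := e1 s hs
  have a2 := e2 s hs
  linear_combination (r s ^ 2 * h1 s) * a2 - (r s ^ 2 * h2 s) * a1 + (C * h1 s ^ 3) * a0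
    - h1 s * (r s * r1 s + (C * h s + D) * h1 s) * a1

/-- With r as parameter the equation is d²h/dr² = -2 ν / r³, which integrates to h = -ν / r + C r +
D. -/
theorem profile_of_parabolic_cubic {ν : ℝ} (hI : IsOpen I) (hc : IsPreconnected I)
    (hr : ∀ s ∈ I, HasDerivAt r (r1 s) s) (hr1 : ∀ s ∈ I, HasDerivAt r1 (r2 s) s)
    (hh : ∀ s ∈ I, HasDerivAt h (h1 s) s) (hh1 : ∀ s ∈ I, HasDerivAt h1 (h2 s) s)
    (pos : ∀ s ∈ I, 0 < r s) (hn : ∀ s ∈ I, r1 s ≠ 0)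
    (eq : ∀ s ∈ I, (r2 s * h1 s - h2 s * r1 s) * r s ^ 3 = 2 * ν * r1 s ^ 3) :
    ∃ C D, ∀ s ∈ I, h s * r s = -ν + C * r s ^ 2 + D * r s := by
  have k1 : ∀ s ∈ I, HasDerivAt (fun s => h1 s / r1 s - ν / r s ^ 2) 0 s := by
    intro s hs
    have n1 := hn s hs
    have n2 := (pos s hs).ne'
    have d2 := (hasDerivAt_const s ν).fun_div ((hr s hs).fun_pow 2) (pow_ne_zero 2 n2)
    refine ((hasDerivAt_slope (hh1 s hs) (hr1 s hs) n1).sub d2).congr_deriv ?_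
    have e : h2 s * r1 s - h1 s * r2 s = -(2 * ν * r1 s ^ 3 / r s ^ 3) := by
      field_simp; linear_combination -eq s hs
    rw [e]
    simp only [Nat.add_one_sub_one, pow_one, Nat.cast_ofNat]
    field_simp
    ring
  obtain ⟨C, hC⟩ := eq_const_of_hasDerivAt_zero hI hc k1
  have k2 : ∀ s ∈ I, HasDerivAt (fun s => h s + ν / r s - C * r s) 0 s := by
    intro s hs
    have n1 := hn s hs
    have n2 := (pos s hs).ne'
    have d2 := (hasDerivAt_const s ν).fun_div (hr s hs) n2
    refine (((hh s hs).add d2).sub ((hr s hs).const_mul C)).congr_deriv ?_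
    have e := hC s hs
    field_simp at e ⊢
    linear_combination e
  obtain ⟨D, hD⟩ := eq_const_of_hasDerivAt_zero hI hc k2
  refine ⟨C, D, fun s hs => ?_⟩
  have n2 := (pos s hs).ne'
  have e := hD s hs
  field_simp at e
  linear_combination e

theorem parabolic_cubic_of_profile {A C D : ℝ} (hI : IsOpen I)
    (hr : ∀ s ∈ I, HasDerivAt r (r1 s) s) (hr1 : ∀ s ∈ I, HasDerivAt r1 (r2 s) s)
    (hh : ∀ s ∈ I, HasDerivAt h (h1 s) s) (hh1 : ∀ s ∈ I, HasDerivAt h1 (h2 s) s)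
    (eq : ∀ s ∈ I, h s * r s = A + C * r s ^ 2 + D * r s) :
    ∀ s ∈ I, (r2 s * h1 s - h2 s * r1 s) * r s ^ 3 = -2 * A * r1 s ^ 3 := by
  have e1 : ∀ s ∈ I, h1 s * r s + h s * r1 s = 2 * C * (r s * r1 s) + D * r1 s := by
    intro s hs
    have := hasDerivAt_unique_on hI (fun s hs => (hh s hs).mul (hr s hs))
      (fun s hs => ((((hr s hs).fun_pow 2).const_mul C).const_add A).add
        ((hr s hs).const_mul D)) eq s hs
    push_cast at this
    linear_combination this
  have e2 := hasDerivAt_unique_on hI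
    (fun s hs => ((hh1 s hs).mul (hr s hs)).add ((hh s hs).mul (hr1 s hs)))
    (fun s hs => (((hr s hs).mul (hr1 s hs)).const_mul (2 * C)).add ((hr1 s hs).const_mul D)) e1
  intro s hs
  have a0 := eq s hs
  have a1 := e1 s hs
  have a2 := e2 s hs
  linear_combination (-(r s ^ 2 * r1 s)) * a2 + (r s ^ 2 * r2 s + 2 * r s * r1 s ^ 2) * a1
    - 2 * r1 s ^ 3 * a0

end

/-! ### Motions preserving the axis, and canonical equations. -/

namespace L3

theorem IsMotion.symm {Φ : L3 ≃ᵃ[ℝ] L3} (h : IsMotion Φ) : IsMotion Φ.symm := fun v w => by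
  rw [← h]; simp

theorem IsMotion.trans {Φ Ψ : L3 ≃ᵃ[ℝ] L3} (h : IsMotion Φ) (h' : IsMotion Ψ) :
    IsMotion (Φ.trans Ψ) := fun v w =>
  (h' _ _).trans (h v w)

/-- The change of the signs of some of the coordinates. -/
def signFlip (σ : Fin 3 → ℤˣ) : L3 ≃ₗ[ℝ] L3 :=
  LinearEquiv.ofInvolutive
    { toFun := fun p i => ((σ i : ℤ) : ℝ) * p i
      map_add' := fun p q => by ext i; simp [mul_add]
      map_smul' := fun c p => by ext i; simp [mul_left_comm] }
    (fun p => by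
      ext i
      rcases Int.units_eq_one_or (σ i) with h | h <;> simp [h])

@[simp] theorem signFlip_apply (σ : Fin 3 → ℤˣ) (p : L3) (i : Fin 3) :
    signFlip σ p i = ((σ i : ℤ) : ℝ) * p i := rfl

theorem units_cast_sq (η : ℤˣ) : ((η : ℤ) : ℝ) ^ 2 = 1 := by
  rcases Int.units_eq_one_or η with h | h <;> simp [h]

theorem form_signFlip (σ : Fin 3 → ℤˣ) (v w : L3) :
    form (signFlip σ v) (signFlip σ w) = form v w := by
  simp only [form, signFlip_apply]
  linear_combination v 0 * w 0 * units_cast_sq (σ 0) + v 1 * w 1 * units_cast_sq (σ 1)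
    - v 2 * w 2 * units_cast_sq (σ 2)

/-- A change of signs followed by a translation. -/
def signMotion (σ : Fin 3 → ℤˣ) (b : L3) : L3 ≃ᵃ[ℝ] L3 :=
  (signFlip σ).toAffineEquiv.trans (AffineEquiv.constVAdd ℝ L3 b)

theorem signMotion_apply (σ : Fin 3 → ℤˣ) (b p : L3) (i : Fin 3) :
    signMotion σ b p i = b i + ((σ i : ℤ) : ℝ) * p i := rfl

theorem isMotion_signMotion (σ : Fin 3 → ℤˣ) (b : L3) : IsMotion (signMotion σ b) :=
  fun v w => form_signFlip σ v w

end L3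

namespace RotationKind

theorem axisDir_ne_zero (τ : RotationKind) : τ.axisDir ≠ 0 := by
  intro h
  cases τ
  · simpa [axisDir] using congrFun h 0
  · simpa [axisDir] using congrFun h 0
  · simpa [axisDir] using congrFun h 2
  · simpa [axisDir] using congrFun h 0

/-- A change of signs whose restriction to the axis is `±1`, followed by a translation along the
axis, preserves the axis. -/
theorem signMotion_image_axis (τ : RotationKind) (σ : Fin 3 → ℤˣ) (η : ℤˣ) (c : ℝ)
    (h : L3.signFlip σ τ.axisDir = ((η : ℤ) : ℝ) • τ.axisDir) :
    L3.signMotion σ (c • τ.axisDir) '' τ.axis = τ.axis := by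
  have key : ∀ k : ℝ, L3.signMotion σ (c • τ.axisDir) (k • τ.axisDir) =
      (c + k * ((η : ℤ) : ℝ)) • τ.axisDir := by
    intro k
    change c • τ.axisDir + L3.signFlip σ (k • τ.axisDir) = _
    rw [map_smul, h, smul_smul, add_smul]
  have h2 := L3.units_cast_sq η
  ext p
  constructor
  · rintro ⟨_, ⟨k, rfl⟩, rfl⟩
    exact ⟨_, key k⟩
  · rintro ⟨k, rfl⟩
    refine ⟨((k - c) * ((η : ℤ) : ℝ)) • τ.axisDir, ⟨_, rfl⟩, ?_⟩
    rw [key]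
    congr 1
    linear_combination (k - c) * h2

theorem motion_axisDir {τ : RotationKind} {Θ : L3 ≃ᵃ[ℝ] L3} (hax : Θ '' τ.axis = τ.axis) :
    ∃ l c : ℝ, l ≠ 0 ∧ Θ.linear τ.axisDir = l • τ.axisDir ∧ Θ 0 = c • τ.axisDir := by
  have h0 : Θ 0 ∈ τ.axis := hax ▸ mem_image_of_mem Θ ⟨0, by simp⟩
  have h1 : Θ τ.axisDir ∈ τ.axis := hax ▸ mem_image_of_mem Θ ⟨1, by simp⟩
  obtain ⟨c, hc⟩ := h0
  obtain ⟨k, hk⟩ := h1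
  have hl : Θ.linear τ.axisDir = (k - c) • τ.axisDir := by
    rw [sub_smul, ← hk, ← hc, L3.motion_apply Θ τ.axisDir, add_sub_cancel_right]
  refine ⟨k - c, c, fun h => τ.axisDir_ne_zero ?_, hl, hc⟩
  rw [h, zero_smul] at hl
  exact Θ.linear.map_eq_zero_iff.1 hl

/-- Both invariants are expressed through the metric and the axis direction alone, so that motions
can be treated for the three classes at once. Here κ is the causal sign of the axis. -/
theorem exists_sqRadius_axialCoord_eq {τ : RotationKind} (hτ : τ ≠ .parabolic) :
    ∃ κ ρ : ℝ, κ ^ 2 = 1 ∧ L3.form τ.axisDir τ.axisDir = κ ∧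
      (∀ p, τ.axialCoord p = κ * L3.form p τ.axisDir) ∧
      ∀ p, τ.sqRadius p = ρ * (L3.form p p - κ * τ.axialCoord p ^ 2) := by
  cases τ
  · refine ⟨1, -1, by norm_num, ?_, fun p => ?_, fun p => ?_⟩ <;>
      (simp [L3.form, axisDir, axialCoord, sqRadius]; try ring)
  · refine ⟨1, 1, by norm_num, ?_, fun p => ?_, fun p => ?_⟩ <;>
      (simp [L3.form, axisDir, axialCoord, sqRadius]; try ring)
  · refine ⟨-1, 1, by norm_num, ?_, fun p => ?_, fun p => ?_⟩ <;>
      (simp [L3.form, axisDir, axialCoord, sqRadius]; try ring)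
  · exact absurd rfl hτ

/-- A motion that preserves a non-lightlike axis acts on the axial coordinate as a motion of the
line, and preserves the distance to the axis. -/
theorem axialCoord_sqRadius_motion {τ : RotationKind} (hτ : τ ≠ .parabolic)
    {Θ : L3 ≃ᵃ[ℝ] L3} (hΘ : L3.IsMotion Θ) (hax : Θ '' τ.axis = τ.axis) :
    ∃ η c : ℝ, η ^ 2 = 1 ∧ ∀ p, τ.axialCoord (Θ p) = η * τ.axialCoord p + c ∧
      τ.sqRadius (Θ p) = τ.sqRadius p := by
  obtain ⟨l, c, -, hd, hc⟩ := motion_axisDir hax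
  obtain ⟨κ, ρ, hκ, hdd, ha, hr⟩ := exists_sqRadius_axialCoord_eq hτ
  -- The axis direction is non-null and its length is preserved.
  have hl : l ^ 2 = 1 := by
    have := hΘ τ.axisDir τ.axisDir
    rw [hd, L3.form_smul_left, L3.form_smul_right, hdd] at this
    linear_combination κ * this + (1 - l ^ 2) * hκ
  have hLd : ∀ p, L3.form (Θ.linear p) τ.axisDir = l * L3.form p τ.axisDir := by
    intro p
    have := hΘ p τ.axisDir
    rw [hd, L3.form_smul_right] at this
    linear_combination l * this - L3.form (Θ.linear p) τ.axisDir * hl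
  have hΘd : ∀ p, L3.form (Θ p) τ.axisDir = l * L3.form p τ.axisDir + c * κ := by
    intro p
    rw [L3.motion_apply, hc, L3.form_add_left, hLd, L3.form_smul_left, hdd]
  have hff : ∀ p, L3.form (Θ p) (Θ p) =
      L3.form p p + 2 * c * l * L3.form p τ.axisDir + c ^ 2 * κ := by
    intro p
    have h2 : L3.form (Θ.linear p) (Θ p) = L3.form p p + c * (l * L3.form p τ.axisDir) := by
      rw [L3.form_comm, L3.motion_apply, hc, L3.form_add_left, hΘ, L3.form_smul_left,
        L3.form_comm τ.axisDir, hLd]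
    conv_lhs => rw [L3.form_comm]
    rw [L3.motion_apply Θ p, L3.form_comm, hc, L3.form_add_left, ← hc, ← L3.motion_apply, h2, hc,
      L3.form_smul_left, L3.form_comm τ.axisDir, hΘd]
    ring
  refine ⟨l, c, hl, fun p => ?_⟩
  have h1 : τ.axialCoord (Θ p) = l * τ.axialCoord p + c := by
    rw [ha, ha, hΘd]; linear_combination c * hκ
  refine ⟨h1, ?_⟩
  rw [hr, hr, h1, hff, ha p]
  linear_combination ρ * (-2 * l * c * L3.form p τ.axisDir) * hκ
    - ρ * κ ^ 3 * L3.form p τ.axisDir ^ 2 * hl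

/-- The effect of a motion that preserves a lightlike axis. -/
theorem form_radius_motion {Θ : L3 ≃ᵃ[ℝ] L3} (hΘ : L3.IsMotion Θ)
    (hax : Θ '' RotationKind.parabolic.axis = RotationKind.parabolic.axis) :
    ∃ l k : ℝ, ∀ p : L3, Θ p 0 - Θ p 2 = l * (p 0 - p 2) ∧
      L3.form (Θ p) (Θ p) = L3.form p p + k * (p 0 - p 2) := by
  obtain ⟨l, c, hl, hd, hc⟩ := motion_axisDir hax
  have hv : ∀ p : L3, L3.form p RotationKind.parabolic.axisDir = p 0 - p 2 := by
    intro p; simp [L3.form, axisDir]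
  -- A null direction may be rescaled by any l ≠ 0, and pairing with it is then rescaled by the
  -- inverse.
  have hLd : ∀ p, L3.form (Θ.linear p) RotationKind.parabolic.axisDir = l⁻¹ * (p 0 - p 2) := by
    intro p
    have := hΘ p RotationKind.parabolic.axisDir
    rw [hd, L3.form_smul_right, hv p] at this
    field_simp
    linear_combination this
  have hΘd : ∀ p, L3.form (Θ p) RotationKind.parabolic.axisDir = l⁻¹ * (p 0 - p 2) := by
    intro p
    rw [L3.motion_apply, hc, L3.form_add_left, hLd, L3.form_smul_left, hv]
    simp [axisDir]
  refine ⟨l⁻¹, 2 * c * l⁻¹, fun p => ⟨by rw [← hv, hΘd], ?_⟩⟩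
  have h2 : L3.form (Θ.linear p) (Θ p) = L3.form p p + c * (l⁻¹ * (p 0 - p 2)) := by
    rw [L3.form_comm, L3.motion_apply, hc, L3.form_add_left, hΘ, L3.form_smul_left,
      L3.form_comm RotationKind.parabolic.axisDir, hLd]
  conv_lhs => rw [L3.form_comm]
  rw [L3.motion_apply Θ p, L3.form_comm, hc, L3.form_add_left, ← hc, ← L3.motion_apply, h2, hc,
    L3.form_smul_left, L3.form_comm RotationKind.parabolic.axisDir, hΘd]
  ring

end RotationKind

open RotationKind

namespace IsQuadricOfRevolution

/-- One normal form for all non-parabolic types; the non-zero discriminant becomes μ ≠ 0. -/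
theorem exists_profile {τ : RotationKind} (hτ : τ ≠ .parabolic) {F : L3 → ℝ}
    (h : IsQuadricOfRevolution τ F) : ∃ C D K : ℝ, D ^ 2 - C * K ≠ 0 ∧
      F = fun p => τ.sqRadius p - (C * τ.axialCoord p ^ 2 + 2 * D * τ.axialCoord p + K) := by
  cases h with
  | ellipsoid _ _ α β hα hβ =>
    exact ⟨-β ^ 2, 0, α ^ 2, by ring_nf; positivity, by funext p; ring⟩
  | oneSheetHyperboloid _ _ α β hα hβ =>
    exact ⟨β ^ 2, 0, α ^ 2, by ring_nf; exact neg_ne_zero.2 (by positivity), by funext p; ring⟩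
  | twoSheetsHyperboloid _ _ α β hα hβ =>
    exact ⟨β ^ 2, 0, -α ^ 2, by ring_nf; positivity, by funext p; ring⟩
  | paraboloid _ _ δ hδ =>
    exact ⟨0, δ / 2, 0, by ring_nf; positivity, by funext p; ring⟩
  | _ => exact absurd rfl hτ

theorem exists_parabolic_profile {F : L3 → ℝ} (h : IsQuadricOfRevolution .parabolic F) :
    ∃ A C : ℝ, A ≠ 0 ∧ F = fun p => L3.form p p - (A + C * (p 0 - p 2) ^ 2) := by
  cases h with
  | parabolic_a α β hα hβ => exact ⟨α ^ 2, -β ^ 2, by positivity, by funext p; ring⟩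
  | parabolic_b α β hα hβ => exact ⟨α ^ 2, β ^ 2, by positivity, by funext p; ring⟩
  | parabolic_c α β hα hβ => exact ⟨-α ^ 2, β ^ 2, by simp [hα.ne'], by funext p; ring⟩
  | parabolic_d α β hα hβ => exact ⟨-α ^ 2, -β ^ 2, by simp [hα.ne'], by funext p; ring⟩
  | _ => contradiction

/-- The four families correspond to the signs of A and C; C = 0 is covered by β = 0. -/
theorem of_parabolic_profile {A : ℝ} (hA : A ≠ 0) (C : ℝ) :
    IsQuadricOfRevolution .parabolic (fun p => L3.form p p - (A + C * (p 0 - p 2) ^ 2)) := by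
  have hα : 0 < Real.sqrt |A| := Real.sqrt_pos.2 (abs_pos.2 hA)
  have hβ : 0 ≤ Real.sqrt |C| := Real.sqrt_nonneg _
  have hα2 : Real.sqrt |A| ^ 2 = |A| := Real.sq_sqrt (abs_nonneg _)
  have hβ2 : Real.sqrt |C| ^ 2 = |C| := Real.sq_sqrt (abs_nonneg _)
  rcases abs_cases A with ⟨h1, -⟩ | ⟨h1, -⟩ <;> rcases abs_cases C with ⟨h2, -⟩ | ⟨h2, -⟩
  · convert parabolic_b _ _ hα hβ using 3 with p
    rw [hα2, hβ2, h1, h2]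
  · convert parabolic_a _ _ hα hβ using 3 with p
    rw [hα2, hβ2, h1, h2]; ring
  · convert parabolic_c _ _ hα hβ using 3 with p
    rw [hα2, hβ2, h1, h2]; ring
  · convert parabolic_d _ _ hα hβ using 3 with p
    rw [hα2, hβ2, h1, h2]; ring

/-- The condition `hpos` discards the one pair of signs, both negative, for which the squared radius
could never be positive. -/
theorem of_central_profile {τ : RotationKind} (hτ : τ ≠ .parabolic) {C K : ℝ} (hC : C ≠ 0)
    (hK : K ≠ 0) (hpos : 0 < C ∨ 0 < K) :
    IsQuadricOfRevolution τ (fun p => τ.sqRadius p - (C * τ.axialCoord p ^ 2 + K)) := by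
  have hα : 0 < Real.sqrt |K| := Real.sqrt_pos.2 (abs_pos.2 hK)
  have hβ : 0 < Real.sqrt |C| := Real.sqrt_pos.2 (abs_pos.2 hC)
  have hα2 : Real.sqrt |K| ^ 2 = |K| := Real.sq_sqrt (abs_nonneg _)
  have hβ2 : Real.sqrt |C| ^ 2 = |C| := Real.sq_sqrt (abs_nonneg _)
  rcases abs_cases K with ⟨h1, h1'⟩ | ⟨h1, h1'⟩ <;>
    rcases abs_cases C with ⟨h2, h2'⟩ | ⟨h2, h2'⟩
  · convert oneSheetHyperboloid τ hτ _ _ hα hβ using 3 with p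
    rw [hα2, hβ2, h1, h2]; ring
  · convert ellipsoid τ hτ _ _ hα hβ using 3 with p
    rw [hα2, hβ2, h1, h2]; ring
  · convert twoSheetsHyperboloid τ hτ _ _ hα hβ using 3 with p
    rw [hα2, hβ2, h1, h2]; ring
  · rcases hpos with h | h <;> linarith

end IsQuadricOfRevolution

namespace RotationKind

/-- The reflection `±1` along a non-lightlike axis. -/
def axialSigns : RotationKind → ℤˣ → Fin 3 → ℤˣ
  | hypFirst, η => ![η, 1, 1]
  | hypSecond, η => ![η, 1, 1]
  | elliptic, η => ![1, 1, η]
  | parabolic, _ => ![1, 1, 1]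

theorem axialMotion_spec {τ : RotationKind} (hτ : τ ≠ .parabolic) (η : ℤˣ) (c : ℝ) :
    L3.signMotion (τ.axialSigns η) (c • τ.axisDir) '' τ.axis = τ.axis ∧
    ∀ p, τ.axialCoord (L3.signMotion (τ.axialSigns η) (c • τ.axisDir) p) =
        ((η : ℤ) : ℝ) * τ.axialCoord p + c ∧
      τ.sqRadius (L3.signMotion (τ.axialSigns η) (c • τ.axisDir) p) = τ.sqRadius p := by
  constructor
  · apply signMotion_image_axis _ _ η
    ext i
    cases τ <;> first | exact absurd rfl hτ | fin_cases i <;> simp [axialSigns, axisDir]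
  · intro p
    cases τ <;> first
      | exact absurd rfl hτ
      | simp [axialSigns, axisDir, axialCoord, sqRadius, L3.signMotion_apply, add_comm]

/-- Reduction of a quadric of revolution with a non-lightlike axis to its canonical equation. -/
theorem exists_canonical_quadric {τ : RotationKind} (hτ : τ ≠ .parabolic) {C D K : ℝ}
    (hdisc : D ^ 2 - C * K ≠ 0) (hpos : ∃ x, 0 < C * x ^ 2 + 2 * D * x + K) :
    ∃ (B : L3 ≃ᵃ[ℝ] L3) (F : L3 → ℝ), L3.IsMotion B ∧ B '' τ.axis = τ.axis ∧
      IsQuadricOfRevolution τ F ∧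
      ∀ p, τ.sqRadius p = C * τ.axialCoord p ^ 2 + 2 * D * τ.axialCoord p + K → F (B p) = 0 := by
  by_cases hC : C = 0
  · subst hC
    have hD : D ≠ 0 := by rintro rfl; simp at hdisc
    obtain ⟨η, hη⟩ : ∃ η : ℤˣ, D = |D| * ((η : ℤ) : ℝ) := by
      rcases abs_cases D with ⟨h, -⟩ | ⟨h, -⟩
      · exact ⟨1, by simp [h]⟩
      · exact ⟨-1, by simp [h]⟩
    have hD' : 0 < |D| := abs_pos.2 hD
    -- From 2 D h + K = 2 |D| (η h + K / (2 |D|)): a reflection makes the coefficient positive and a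
    -- translation removes the constant.
    obtain ⟨h1, h2⟩ := axialMotion_spec hτ η (K / (2 * |D|))
    refine ⟨_, _, L3.isMotion_signMotion _ _, h1,
      IsQuadricOfRevolution.paraboloid τ hτ (2 * |D|) (by positivity), fun p hp => ?_⟩
    rw [(h2 p).1, (h2 p).2, hp]
    field_simp
    linear_combination 2 * τ.axialCoord p * hη
  -- Completing the square: the translation by D / C leaves the constant K - D² / C, non-zero by the
  -- discriminant.
  · obtain ⟨h1, h2⟩ := axialMotion_spec hτ 1 (D / C)
    have hK : K - D ^ 2 / C ≠ 0 := by
      intro h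
      apply hdisc
      field_simp at h
      linarith
    refine ⟨_, _, L3.isMotion_signMotion _ _, h1,
      IsQuadricOfRevolution.of_central_profile hτ hC hK ?_, fun p hp => ?_⟩
    · by_contra! h
      obtain ⟨x, hx⟩ := hpos
      have e : C * x ^ 2 + 2 * D * x + K = C * (x + D / C) ^ 2 + (K - D ^ 2 / C) := by
        field_simp; ring
      nlinarith [mul_nonneg (neg_nonneg.2 h.1) (sq_nonneg (x + D / C))]
    · rw [(h2 p).1, (h2 p).2, hp]
      simp only [Units.val_one, Int.cast_one]
      field_simp
      ring

/-- Translating by c along the null axis keeps p 0 - p 2 and adds 2 c (p 0 - p 2) to the quadratic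
form; c = -D / 2 removes the linear term. -/
theorem exists_canonical_parabolic_quadric {A : ℝ} (hA : A ≠ 0) (C D : ℝ) :
    ∃ (B : L3 ≃ᵃ[ℝ] L3) (F : L3 → ℝ), L3.IsMotion B ∧
      B '' RotationKind.parabolic.axis = RotationKind.parabolic.axis ∧
      IsQuadricOfRevolution .parabolic F ∧
      ∀ p : L3, L3.form p p = A + C * (p 0 - p 2) ^ 2 + D * (p 0 - p 2) → F (B p) = 0 := by
  refine ⟨L3.signMotion 1 ((-D / 2) • RotationKind.parabolic.axisDir), _,
    L3.isMotion_signMotion _ _, signMotion_image_axis _ _ 1 _ ?_,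
    IsQuadricOfRevolution.of_parabolic_profile hA C, fun p hp => ?_⟩
  · ext i
    fin_cases i <;> simp [axisDir]
  · simp only [L3.form] at hp
    simp [L3.form, L3.signMotion_apply, axisDir]
    linear_combination hp

end RotationKind

/-! ### Invariants under rotation and profile coordinates of the generatrix. -/

namespace RotationKind

theorem sqRadius_rotation (τ : RotationKind) (t : ℝ) (p : L3) :
    τ.sqRadius (τ.rotation t p) = τ.sqRadius p := by
  have h1 := Real.cosh_sq t
  have h2 := Real.sin_sq_add_cos_sq t
  cases τ <;> simp [rotation, sqRadius]
  · linear_combination (p 2 ^ 2 - p 1 ^ 2) * h1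
  · linear_combination (p 1 ^ 2 - p 2 ^ 2) * h1
  · linear_combination (p 0 ^ 2 + p 1 ^ 2) * h2
  · ring

theorem axialCoord_rotation {τ : RotationKind} (hτ : τ ≠ .parabolic) (t : ℝ) (p : L3) :
    τ.axialCoord (τ.rotation t p) = τ.axialCoord p := by
  cases τ <;> first | exact absurd rfl hτ | simp [rotation, axialCoord]

theorem parabolic_rotation_sub (t : ℝ) (p : L3) :
    RotationKind.parabolic.rotation t p 0 - RotationKind.parabolic.rotation t p 2 =
      p 0 - p 2 := by
  simp [rotation]; ring

/-- The factor that relates `meridianBend` to the Wronskian of the profile velocity. -/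
def bendFactor : RotationKind → ℝ
  | hypFirst => 1
  | hypSecond => 1
  | elliptic => -1
  | parabolic => 1 / 2

theorem bendFactor_sq {τ : RotationKind} (hτ : τ ≠ .parabolic) : τ.bendFactor ^ 2 = 1 := by
  cases τ <;> first | exact absurd rfl hτ | simp [bendFactor]

theorem meridianBend_eq (τ : RotationKind) (v a : L3) :
    τ.meridianBend v a = τ.bendFactor *
      (τ.radius a * τ.axialCoord v - τ.axialCoord a * τ.radius v) := by
  cases τ <;> (simp [meridianBend, bendFactor, radius, axialCoord]; try ring)

theorem parallelBend_eq {τ : RotationKind} (hτ : τ ≠ .parabolic) (v : L3) :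
    τ.parallelBend v = τ.axialCoord v := by
  cases τ <;> first | exact absurd rfl hτ | rfl

theorem sqRadius_of_mem_plane {τ : RotationKind} {p : L3} (hp : p ∈ τ.plane) :
    τ.sqRadius p = τ.radius p ^ 2 := by
  cases τ <;> simp only [plane, mem_ofPred_eq] at hp <;> simp [sqRadius, radius, hp]

theorem parabolic_form_of_mem_plane {p : L3} (hp : p ∈ RotationKind.parabolic.plane) :
    L3.form p p = RotationKind.parabolic.axialCoord p * RotationKind.parabolic.radius p := by
  simp only [plane, mem_ofPred_eq] at hp
  simp [L3.form, radius, axialCoord, hp]; ring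

theorem form_eq_zero_of_mem_plane {τ : RotationKind} {v : L3} (hv : v ∈ τ.plane)
    (h1 : τ.axialCoord v = 0) (h2 : τ.radius v = 0) : L3.form v v = 0 := by
  cases τ <;> simp only [plane, mem_ofPred_eq, axialCoord, radius] at hv h1 h2
  · simp [L3.form, hv, h1, h2]
  · simp [L3.form, hv, h1, h2]
  · simp [L3.form, hv, h1, h2]
  · simp only [L3.form, hv]; linear_combination (v 0 - v 2) * h1

theorem hasDerivAt_radius (τ : RotationKind) {γ : ℝ → L3} {v : L3} {s : ℝ}
    (h : HasDerivAt γ v s) : HasDerivAt (fun s => τ.radius (γ s)) (τ.radius v) s := by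
  rw [hasDerivAt_pi] at h
  cases τ
  · exact h 2
  · exact h 1
  · exact h 0
  · exact (h 0).sub (h 2)

theorem hasDerivAt_axialCoord (τ : RotationKind) {γ : ℝ → L3} {v : L3} {s : ℝ}
    (h : HasDerivAt γ v s) : HasDerivAt (fun s => τ.axialCoord (γ s)) (τ.axialCoord v) s := by
  rw [hasDerivAt_pi] at h
  cases τ
  · exact h 0
  · exact h 0
  · exact h 2
  · exact (h 0).add (h 2)

end RotationKind

/-! ### The relation is equivalent to a canonical equation. -/

namespace RotationalSurface
variable {S : RotationalSurface}

theorem isPreconnected_I : IsPreconnected S.I :=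
  S.I_connected.isPreconnected

/-- The causal character is constant. -/
theorem exists_causal_sign (S : RotationalSurface) : ∃ ε : ℝ, (ε = 1 ∨ ε = -1) ∧ ∀ s ∈ S.I,
    S.kind.parallelSign * L3.form (deriv S.γ s) (deriv S.γ s) =
      ε * |L3.form (deriv S.γ s) (deriv S.γ s)| := by
  have hc : ContinuousOn (fun s => L3.form (deriv S.γ s) (deriv S.γ s)) S.I := by
    have h := contDiffOn_deriv_γ (S := S).continuousOn
    have hi : ∀ i, ContinuousOn (fun s => deriv S.γ s i) S.I := continuousOn_pi.1 h
    exact (((hi 0).mul (hi 0)).add ((hi 1).mul (hi 1))).sub ((hi 2).mul (hi 2))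
  have h := isPreconnected_I.eq_or_eq_neg_of_sq_eq hc hc.abs
    (fun s _ => by simp) (fun {s} hs => abs_ne_zero.2 (S.γ_nonnull s hs))
  have hp : S.kind.parallelSign = 1 ∨ S.kind.parallelSign = -1 := by
    cases S.kind <;> simp [RotationKind.parallelSign]
  obtain ⟨ε, hε, hεE⟩ : ∃ ε : ℝ, (ε = 1 ∨ ε = -1) ∧ ∀ s ∈ S.I,
      L3.form (deriv S.γ s) (deriv S.γ s) = ε * |L3.form (deriv S.γ s) (deriv S.γ s)| := by
    rcases h with h | h
    · exact ⟨1, Or.inl rfl, fun s hs => by simpa using h hs⟩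
    · exact ⟨-1, Or.inr rfl, fun s hs => by simpa using h hs⟩
  refine ⟨S.kind.parallelSign * ε, ?_, fun s hs => ?_⟩
  · rcases hp with hp | hp <;> rcases hε with hε | hε <;> simp [hp, hε]
  · rw [mul_assoc, ← hεE s hs]

/-- The sign ε is 1 on spacelike and -1 on timelike surfaces. Once it is fixed, the factor |E|
cancels and the profile equation with constant coefficient remains. -/
theorem cubicWeingarten_iff_of_causal_sign {ε : ℝ} (hε : ε = 1 ∨ ε = -1)
    (h : ∀ s ∈ S.I, S.kind.parallelSign * L3.form (deriv S.γ s) (deriv S.γ s) =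
      ε * |L3.form (deriv S.γ s) (deriv S.γ s)|) (μ : ℝ) :
    S.CubicWeingarten μ ↔ ∀ s ∈ S.I, S.kind.bendFactor *
      ((S.kind.radius (deriv (deriv S.γ) s) * S.kind.axialCoord (deriv S.γ s) -
        S.kind.axialCoord (deriv (deriv S.γ) s) * S.kind.radius (deriv S.γ s)) *
        S.kind.radius (S.γ s) ^ 3) = ε * μ * S.kind.parallelBend (deriv S.γ s) ^ 3 := by
  rw [cubicWeingarten_iff]
  refine forall₂_congr fun s hs => ?_
  have hE := abs_ne_zero.2 (S.γ_nonnull s hs)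
  have hε2 : ε * ε = 1 := by rcases hε with rfl | rfl <;> norm_num
  have hε0 : ε ≠ 0 := by rintro rfl; simp at hε2
  rw [h s hs, S.kind.meridianBend_eq, ← mul_assoc, mul_left_inj' hE, ← mul_right_inj' hε0]
  constructor <;> intro H
  · linear_combination H - S.kind.bendFactor *
      ((S.kind.radius (deriv (deriv S.γ) s) * S.kind.axialCoord (deriv S.γ s) -
        S.kind.axialCoord (deriv (deriv S.γ) s) * S.kind.radius (deriv S.γ s)) *
        S.kind.radius (S.γ s) ^ 3) * hε2
  · linear_combination H + S.kind.bendFactor *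
      ((S.kind.radius (deriv (deriv S.γ) s) * S.kind.axialCoord (deriv S.γ s) -
        S.kind.axialCoord (deriv (deriv S.γ) s) * S.kind.radius (deriv S.γ s)) *
        S.kind.radius (S.γ s) ^ 3) * hε2

theorem hasDerivAt_profile (S : RotationalSurface) :
    (∀ s ∈ S.I, HasDerivAt (fun s => S.kind.radius (S.γ s)) (S.kind.radius (deriv S.γ s)) s) ∧
    (∀ s ∈ S.I, HasDerivAt (fun s => S.kind.radius (deriv S.γ s))
      (S.kind.radius (deriv (deriv S.γ) s)) s) ∧
    (∀ s ∈ S.I, HasDerivAt (fun s => S.kind.axialCoord (S.γ s))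
      (S.kind.axialCoord (deriv S.γ s)) s) ∧
    (∀ s ∈ S.I, HasDerivAt (fun s => S.kind.axialCoord (deriv S.γ s))
      (S.kind.axialCoord (deriv (deriv S.γ) s)) s) :=
  ⟨fun _ hs => S.kind.hasDerivAt_radius (hasDerivAt_γ hs),
    fun _ hs => S.kind.hasDerivAt_radius (hasDerivAt_deriv_γ hs),
    fun _ hs => S.kind.hasDerivAt_axialCoord (hasDerivAt_γ hs),
    fun _ hs => S.kind.hasDerivAt_axialCoord (hasDerivAt_deriv_γ hs)⟩

theorem radius_pos (s : ℝ) (hs : s ∈ S.I) : 0 < S.kind.radius (S.γ s) :=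
  RotationKind.radius_pos_of_mem_halfPlane (S.γ_mem s hs)

theorem profile_of_cubicWeingarten (hτ : S.kind ≠ .parabolic) {μ : ℝ} (hμ : μ ≠ 0)
    (h : S.CubicWeingarten μ) : (∃ c, ∀ s ∈ S.I, S.kind.axialCoord (S.γ s) = c) ∨
      ∃ C D K, D ^ 2 - C * K ≠ 0 ∧ ∀ s ∈ S.I, S.kind.radius (S.γ s) ^ 2 =
        C * S.kind.axialCoord (S.γ s) ^ 2 + 2 * D * S.kind.axialCoord (S.γ s) + K := by
  obtain ⟨ε, hε, hE⟩ := S.exists_causal_sign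
  rw [cubicWeingarten_iff_of_causal_sign hε hE] at h
  obtain ⟨d1, d2, d3, d4⟩ := S.hasDerivAt_profile
  have hb := RotationKind.bendFactor_sq hτ
  have hb0 : S.kind.bendFactor ≠ 0 := by rintro h; simp [h] at hb
  have hε0 : ε ≠ 0 := by rcases hε with rfl | rfl <;> norm_num
  -- The relation is multiplied by `bendFactor`, whose square is 1. Regularity holds because a
  -- velocity with h' = r' = 0 would be null.
  rcases profile_of_cubic (ν := S.kind.bendFactor * ε * μ) S.I_open isPreconnected_I S.I_nonempty
    d1 d2 d3 d4 radius_pos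
    (fun s hs h1 h2 => S.γ_nonnull s hs
      (RotationKind.form_eq_zero_of_mem_plane (velocity_mem_plane hs) h1 h2))
    (fun s hs => by
      have := h s hs
      rw [RotationKind.parallelBend_eq hτ] at this
      linear_combination S.kind.bendFactor * this - (
        (S.kind.radius (deriv (deriv S.γ) s) * S.kind.axialCoord (deriv S.γ s) -
        S.kind.axialCoord (deriv (deriv S.γ) s) * S.kind.radius (deriv S.γ s)) *
        S.kind.radius (S.γ s) ^ 3) * hb) with H | ⟨C, D, K, hd, H⟩
  · exact Or.inl H
  · refine Or.inr ⟨C, D, K, ?_, H⟩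
    rw [hd]
    exact neg_ne_zero.2 (mul_ne_zero (mul_ne_zero hb0 hε0) hμ)

theorem cubicWeingarten_of_profile (hτ : S.kind ≠ .parabolic) {ε : ℝ} (hε : ε = 1 ∨ ε = -1)
    (hE : ∀ s ∈ S.I, S.kind.parallelSign * L3.form (deriv S.γ s) (deriv S.γ s) =
      ε * |L3.form (deriv S.γ s) (deriv S.γ s)|) {C D K : ℝ}
    (H : ∀ s ∈ S.I, S.kind.radius (S.γ s) ^ 2 =
        C * S.kind.axialCoord (S.γ s) ^ 2 + 2 * D * S.kind.axialCoord (S.γ s) + K) :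
    S.CubicWeingarten (ε * (S.kind.bendFactor * (C * K - D ^ 2))) := by
  rw [cubicWeingarten_iff_of_causal_sign hε hE]
  obtain ⟨d1, d2, d3, d4⟩ := S.hasDerivAt_profile
  intro s hs
  rw [cubic_of_profile S.I_open d1 d2 d3 d4 H s hs, RotationKind.parallelBend_eq hτ]
  rcases hε with rfl | rfl <;> ring

/-- Here h' = h'' = 0, so both sides of the profile equation vanish whatever the constant. -/
theorem cubicWeingarten_of_axialCoord_eq_const (hτ : S.kind ≠ .parabolic) {c : ℝ}
    (H : ∀ s ∈ S.I, S.kind.axialCoord (S.γ s) = c) (μ : ℝ) : S.CubicWeingarten μ := by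
  obtain ⟨ε, hε, hE⟩ := S.exists_causal_sign
  rw [cubicWeingarten_iff_of_causal_sign hε hE]
  obtain ⟨d1, d2, d3, d4⟩ := S.hasDerivAt_profile
  have h1 := hasDerivAt_unique_on S.I_open d3 (fun s _ => hasDerivAt_const s c) H
  have h2 := hasDerivAt_unique_on S.I_open d4 (fun s _ => hasDerivAt_const s (0 : ℝ)) h1
  intro s hs
  rw [RotationKind.parallelBend_eq hτ, h1 s hs, h2 s hs]
  ring

theorem parabolic_profile_of_cubicWeingarten (hτ : S.kind = .parabolic) {μ : ℝ} (hμ : μ ≠ 0)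
    (h : S.CubicWeingarten μ) : ∃ A C D, A ≠ 0 ∧ ∀ s ∈ S.I,
      S.kind.axialCoord (S.γ s) * S.kind.radius (S.γ s) =
        A + C * S.kind.radius (S.γ s) ^ 2 + D * S.kind.radius (S.γ s) := by
  obtain ⟨ε, hε, hE⟩ := S.exists_causal_sign
  rw [cubicWeingarten_iff_of_causal_sign hε hE] at h
  obtain ⟨d1, d2, d3, d4⟩ := S.hasDerivAt_profile
  have hε0 : ε ≠ 0 := by rcases hε with rfl | rfl <;> norm_num
  -- In null coordinates the squared length of the velocity is h' r', so a non-null generatrix has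
  -- r' ≠ 0.
  have hn : ∀ s ∈ S.I, S.kind.radius (deriv S.γ s) ≠ 0 := by
    intro s hs h0
    apply S.γ_nonnull s hs
    have hv := velocity_mem_plane hs
    rw [hτ] at hv h0
    rw [RotationKind.parabolic_form_of_mem_plane hv, h0, mul_zero]
  obtain ⟨C, D, H⟩ := profile_of_parabolic_cubic (ν := ε * μ) S.I_open isPreconnected_I
    d1 d2 d3 d4 radius_pos hn (fun s hs => by
      have := h s hs
      have hb : S.kind.bendFactor = 1 / 2 := by rw [hτ]; rfl
      have hp : S.kind.parallelBend (deriv S.γ s) = S.kind.radius (deriv S.γ s) := by rw [hτ]; rfl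
      rw [hb, hp] at this
      linear_combination 2 * this)
  exact ⟨-(ε * μ), C, D, neg_ne_zero.2 (mul_ne_zero hε0 hμ), H⟩

theorem cubicWeingarten_of_parabolic_profile (hτ : S.kind = .parabolic) {ε : ℝ}
    (hε : ε = 1 ∨ ε = -1)
    (hE : ∀ s ∈ S.I, S.kind.parallelSign * L3.form (deriv S.γ s) (deriv S.γ s) =
      ε * |L3.form (deriv S.γ s) (deriv S.γ s)|) {A C D : ℝ}
    (H : ∀ s ∈ S.I, S.kind.axialCoord (S.γ s) * S.kind.radius (S.γ s) =
        A + C * S.kind.radius (S.γ s) ^ 2 + D * S.kind.radius (S.γ s)) :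
    S.CubicWeingarten (ε * -A) := by
  rw [cubicWeingarten_iff_of_causal_sign hε hE]
  obtain ⟨d1, d2, d3, d4⟩ := S.hasDerivAt_profile
  intro s hs
  have hb : S.kind.bendFactor = 1 / 2 := by rw [hτ]; rfl
  have hp : S.kind.parallelBend (deriv S.γ s) = S.kind.radius (deriv S.γ s) := by rw [hτ]; rfl
  rw [parabolic_cubic_of_profile S.I_open d1 d2 d3 d4 H s hs, hb, hp]
  rcases hε with rfl | rfl <;> ring

/-- Containment of the surface in the image of a level set, in canonical position. -/
theorem carrier_subset_iff (S : RotationalSurface) (Ψ : L3 ≃ᵃ[ℝ] L3) (F : L3 → ℝ) :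
    S.carrier ⊆ Ψ '' {p | F p = 0} ↔
      ∀ s ∈ S.I, ∀ t, F ((S.motion.trans Ψ.symm) (S.kind.rotation t (S.γ s))) = 0 := by
  constructor
  · intro h s hs t
    obtain ⟨q, hq, e⟩ := h ⟨s, hs, t, rfl⟩
    have : (S.motion.trans Ψ.symm) (S.kind.rotation t (S.γ s)) = q :=
      (AffineEquiv.symm_apply_eq Ψ).2 e.symm
    rw [this]
    exact hq
  · rintro h _ ⟨s, hs, t, rfl⟩
    exact ⟨_, h s hs t, Ψ.apply_symm_apply _⟩

theorem sqRadius_rotation_γ {s : ℝ} (hs : s ∈ S.I) (t : ℝ) :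
    S.kind.sqRadius (S.kind.rotation t (S.γ s)) = S.kind.radius (S.γ s) ^ 2 := by
  rw [RotationKind.sqRadius_rotation, RotationKind.sqRadius_of_mem_plane (γ_mem_plane hs)]

theorem image_axis_trans_symm {Ψ : L3 ≃ᵃ[ℝ] L3} (h : Ψ '' S.kind.axis = S.axis) :
    (S.motion.trans Ψ.symm) '' S.kind.axis = S.kind.axis := by
  have h1 : (S.motion.trans Ψ.symm) '' S.kind.axis = Ψ.symm '' S.axis := by
    rw [axis, image_image]; rfl
  rw [h1, ← h, image_image]
  simp

theorem image_symm_trans_axis {B : L3 ≃ᵃ[ℝ] L3} (h : B '' S.kind.axis = S.kind.axis) :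
    (B.symm.trans S.motion) '' S.kind.axis = S.axis := by
  have h1 : (B.symm.trans S.motion) '' S.kind.axis = S.motion '' (B.symm '' S.kind.axis) := by
    rw [image_image]; rfl
  rw [h1, axis]
  congr 1
  conv_lhs => rw [← h, image_image]
  simp

theorem exists_canonical_equation {μ : ℝ} (hμ : μ ≠ 0) (h : S.CubicWeingarten μ) :
    ∃ (B : L3 ≃ᵃ[ℝ] L3) (F : L3 → ℝ), L3.IsMotion B ∧ B '' S.kind.axis = S.kind.axis ∧
      (IsPlaneOfRevolution S.kind F ∨ IsQuadricOfRevolution S.kind F) ∧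
      ∀ s ∈ S.I, ∀ t, F (B (S.kind.rotation t (S.γ s))) = 0 := by
  by_cases hτ : S.kind = .parabolic
  · obtain ⟨A, C, D, hA, H⟩ := parabolic_profile_of_cubicWeingarten hτ hμ h
    obtain ⟨B, F, h1, h2, h3, h4⟩ := RotationKind.exists_canonical_parabolic_quadric hA C D
    rw [hτ] at H ⊢
    refine ⟨B, F, h1, h2, Or.inr h3, fun s hs t => h4 _ ?_⟩
    have hp := γ_mem_plane hs
    rw [hτ] at hp
    rw [RotationKind.form_rotation, RotationKind.parabolic_rotation_sub,
      RotationKind.parabolic_form_of_mem_plane hp]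
    exact H s hs
  · rcases profile_of_cubicWeingarten hτ hμ h with ⟨c, H⟩ | ⟨C, D, K, hd, H⟩
    · refine ⟨AffineEquiv.refl ℝ L3, _, fun _ _ => rfl, by simp, Or.inl ⟨hτ, c, rfl⟩,
        fun s hs t => ?_⟩
      simp only [AffineEquiv.refl_apply, RotationKind.axialCoord_rotation hτ]
      rw [H s hs, sub_self]
    -- Any point of the generatrix shows that the quadratic takes a positive value, namely r².
    · obtain ⟨s₀, hs₀⟩ := S.I_nonempty
      obtain ⟨B, F, h1, h2, h3, h4⟩ := RotationKind.exists_canonical_quadric hτ hd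
        ⟨S.kind.axialCoord (S.γ s₀), by
          rw [← H s₀ hs₀]; exact pow_pos (radius_pos s₀ hs₀) 2⟩
      refine ⟨B, F, h1, h2, Or.inr h3, fun s hs t => h4 _ ?_⟩
      rw [RotationKind.axialCoord_rotation hτ, sqRadius_rotation_γ hs, H s hs]

theorem exists_cubicWeingarten {Θ : L3 ≃ᵃ[ℝ] L3} {F : L3 → ℝ} (hΘ : L3.IsMotion Θ)
    (hax : Θ '' S.kind.axis = S.kind.axis)
    (hF : IsPlaneOfRevolution S.kind F ∨ IsQuadricOfRevolution S.kind F)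
    (h : ∀ s ∈ S.I, ∀ t, F (Θ (S.kind.rotation t (S.γ s))) = 0) :
    ∃ μ : ℝ, μ ≠ 0 ∧ S.CubicWeingarten μ := by
  obtain ⟨ε, hε, hE⟩ := S.exists_causal_sign
  have hε0 : ε ≠ 0 := by rcases hε with rfl | rfl <;> norm_num
  by_cases hτ : S.kind = .parabolic
  · have hF' : IsQuadricOfRevolution .parabolic F := by
      rcases hF with hF | hF
      · exact absurd hτ hF.1
      · rwa [hτ] at hF
    obtain ⟨A, C, hA, rfl⟩ := hF'.exists_parabolic_profile
    rw [hτ] at hax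
    obtain ⟨l, k, hlk⟩ := RotationKind.form_radius_motion hΘ hax
    refine ⟨ε * -A, mul_ne_zero hε0 (neg_ne_zero.2 hA),
      cubicWeingarten_of_parabolic_profile hτ hε hE (C := C * l ^ 2) (D := -k) fun s hs => ?_⟩
    have := h s hs 0
    have hp := γ_mem_plane hs
    rw [hτ] at hp this ⊢
    beta_reduce at this
    rw [(hlk _).1, (hlk _).2, RotationKind.form_rotation, RotationKind.parabolic_rotation_sub,
      RotationKind.parabolic_form_of_mem_plane hp] at this
    simp only [RotationKind.radius] at this ⊢
    linear_combination this
  · obtain ⟨η, c, hη, hΘ'⟩ := RotationKind.axialCoord_sqRadius_motion hτ hΘ hax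
    rcases hF with ⟨-, d, rfl⟩ | hF
    · refine ⟨1, one_ne_zero, cubicWeingarten_of_axialCoord_eq_const hτ (c := η * (d - c))
        (fun s hs => ?_) 1⟩
      have := h s hs 0
      simp only [(hΘ' _).1, RotationKind.axialCoord_rotation hτ] at this
      linear_combination η * this - S.kind.axialCoord (S.γ s) * hη
    · obtain ⟨C, D, K, hd, rfl⟩ := hF.exists_profile hτ
      -- The coefficients are those of the quadratic evaluated at η h + c; its discriminant is again
      -- D² - C K since η² = 1.
      have hd' : C * (C * c ^ 2 + 2 * D * c + K) - (η * (C * c + D)) ^ 2 ≠ 0 := by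
        intro h0
        apply hd
        linear_combination -h0 - (C * c + D) ^ 2 * hη
      have hb : S.kind.bendFactor ≠ 0 := by
        have := RotationKind.bendFactor_sq hτ
        rintro h; simp [h] at this
      refine ⟨_, mul_ne_zero hε0 (mul_ne_zero hb hd'), cubicWeingarten_of_profile hτ hε hE
        fun s hs => ?_⟩
      have := h s hs 0
      simp only [(hΘ' _).1, (hΘ' _).2, RotationKind.axialCoord_rotation hτ,
        sqRadius_rotation_γ hs] at this
      linear_combination this + C * S.kind.axialCoord (S.γ s) ^ 2 * hη

theorem exists_cubicWeingarten_iff (S : RotationalSurface) :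
    (∃ μ : ℝ, μ ≠ 0 ∧ S.CubicWeingarten μ) ↔
      ∃ (Ψ : L3 ≃ᵃ[ℝ] L3) (F : L3 → ℝ),
        L3.IsMotion Ψ ∧ Ψ '' S.kind.axis = S.axis ∧
        (IsPlaneOfRevolution S.kind F ∨ IsQuadricOfRevolution S.kind F) ∧
        S.carrier ⊆ Ψ '' {p | F p = 0} := by
  constructor
  · rintro ⟨μ, hμ, h⟩
    obtain ⟨B, F, hB, hax, hF, H⟩ := exists_canonical_equation hμ h
    refine ⟨B.symm.trans S.motion, F, hB.symm.trans S.isMotion, image_symm_trans_axis hax, hF, ?_⟩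
    rw [carrier_subset_iff]
    intro s hs t
    have e : (S.motion.trans (B.symm.trans S.motion).symm) (S.kind.rotation t (S.γ s)) =
        B (S.kind.rotation t (S.γ s)) :=
      congrArg B (S.motion.symm_apply_apply _)
    rw [e]
    exact H s hs t
  · rintro ⟨Ψ, F, hΨ, hax, hF, h⟩
    exact exists_cubicWeingarten (S.isMotion.trans hΨ.symm) (image_axis_trans_symm hax) hF
      ((carrier_subset_iff S Ψ F).1 h)

end RotationalSurface

/-! ### Rotational surfaces through the non-degenerate points of each quadric. -/

theorem fderiv_apply_eq_of_quadratic {F : L3 → ℝ} {p v : L3} (hF : DifferentiableAt ℝ F p)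
    (a b c : ℝ) (h : ∀ t : ℝ, F (p + t • v) = a + b * t + c * t ^ 2) : fderiv ℝ F p v = b := by
  rw [← hF.lineDeriv_eq_fderiv, lineDeriv, funext h]
  have h1 := (((hasDerivAt_id (0 : ℝ)).const_mul b).const_add a).add
    ((hasDerivAt_pow 2 (0 : ℝ)).const_mul c)
  exact h1.deriv.trans (by simp)

namespace RotationKind

/-- The point of the plane of the generatrices with given radius and axial coordinate. -/
def profilePoint : RotationKind → ℝ → ℝ → L3
  | hypFirst, r, h => ![h, 0, r]
  | hypSecond, r, h => ![h, r, 0]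
  | elliptic, r, h => ![r, 0, h]
  | parabolic, r, h => ![(h + r) / 2, 0, (h - r) / 2]

@[simp] theorem radius_profilePoint (τ : RotationKind) (r h : ℝ) :
    τ.radius (τ.profilePoint r h) = r := by
  cases τ <;> simp [radius, profilePoint]
  ring

@[simp] theorem axialCoord_profilePoint (τ : RotationKind) (r h : ℝ) :
    τ.axialCoord (τ.profilePoint r h) = h := by
  cases τ <;> simp [axialCoord, profilePoint]
  ring

theorem profilePoint_mem_halfPlane (τ : RotationKind) {r : ℝ} (hr : 0 < r) (h : ℝ) :
    τ.profilePoint r h ∈ τ.halfPlane := by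
  cases τ <;> simp [halfPlane, profilePoint, hr]
  linarith

theorem profilePoint_of_mem_plane {τ : RotationKind} {p : L3} (hp : p ∈ τ.plane) :
    τ.profilePoint (τ.radius p) (τ.axialCoord p) = p := by
  ext i
  cases τ <;> simp only [plane, mem_ofPred_eq] at hp <;> fin_cases i <;>
    simp [radius, axialCoord, profilePoint, hp]

theorem hasDerivAt_profilePoint (τ : RotationKind) {r h : ℝ → ℝ} {r' h' s : ℝ}
    (hr : HasDerivAt r r' s) (hh : HasDerivAt h h' s) :
    HasDerivAt (fun s => τ.profilePoint (r s) (h s)) (τ.profilePoint r' h') s := by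
  rw [hasDerivAt_pi]
  have h0 := hasDerivAt_const s (0 : ℝ)
  intro i
  cases τ <;> fin_cases i
  exacts [hh, h0, hr, hh, hr, h0, hr, h0, hh, (hh.add hr).div_const 2, h0,
    (hh.sub hr).div_const 2]

theorem contDiffOn_profilePoint (τ : RotationKind) {n : WithTop ℕ∞} {r h : ℝ → ℝ} {U : Set ℝ}
    (hr : ContDiffOn ℝ n r U) (hh : ContDiffOn ℝ n h U) :
    ContDiffOn ℝ n (fun s => τ.profilePoint (r s) (h s)) U := by
  rw [contDiffOn_pi]
  have h0 : ContDiffOn ℝ n (fun _ : ℝ => (0 : ℝ)) U := contDiffOn_const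
  intro i
  cases τ <;> fin_cases i
  exacts [hh, h0, hr, hh, hr, h0, hr, h0, hh, (hh.add hr).div_const 2, h0,
    (hh.sub hr).div_const 2]

theorem hypSecond_form_nonneg {v : L3} (hv : v ∈ RotationKind.hypSecond.plane) :
    0 ≤ L3.form v v := by
  simp only [plane, mem_ofPred_eq] at hv
  simp only [L3.form, hv]
  nlinarith [mul_self_nonneg (v 0), mul_self_nonneg (v 1)]

/-- The sign of this function distinguishes the two components of the complement of the null
cone (or null plane) of the axis in which the generatrices of the class and their reflections
lie. -/
def side : RotationKind → L3 → ℝ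
  | hypFirst, p => p 2
  | hypSecond, p => p 1
  | elliptic, _ => 1
  | parabolic, p => p 0 - p 2

/-- Hyperbolic polar coordinates in the quadrant b > |a|: r = √(b² - a²) and sinh t = a / r. -/
theorem hyperbolic_polar {a b : ℝ} (hb : 0 < b) (h : 0 < b ^ 2 - a ^ 2) :
    ∃ r t : ℝ, 0 < r ∧ a = r * Real.sinh t ∧ b = r * Real.cosh t := by
  have hr : 0 < Real.sqrt (b ^ 2 - a ^ 2) := Real.sqrt_pos.2 h
  have hr2 := Real.sq_sqrt h.le
  set r := Real.sqrt (b ^ 2 - a ^ 2)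
  refine ⟨r, Real.arsinh (a / r), hr, ?_, ?_⟩
  · rw [Real.sinh_arsinh]; field_simp
  · have hc := Real.cosh_sq (Real.arsinh (a / r))
    rw [Real.sinh_arsinh] at hc
    have hcp := Real.cosh_pos (Real.arsinh (a / r))
    rw [← sq_eq_sq₀ hb.le (by positivity), mul_pow, hc]
    field_simp
    linarith

theorem exists_rotation_of_side_pos {τ : RotationKind} {p : L3} (h : 0 < τ.sqRadius p)
    (hs : 0 < τ.side p) : ∃ t : ℝ, ∃ q ∈ τ.halfPlane, τ.rotation t q = p := by
  cases τ <;> simp only [sqRadius, side] at h hs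
  · obtain ⟨r, t, hr, h1, h2⟩ := hyperbolic_polar hs h
    refine ⟨t, ![p 0, 0, r], ⟨rfl, hr⟩, ?_⟩
    ext i
    fin_cases i <;> simp [rotation, h1, h2]
  · obtain ⟨r, t, hr, h1, h2⟩ := hyperbolic_polar hs h
    refine ⟨t, ![p 0, r, 0], ⟨rfl, hr⟩, ?_⟩
    ext i
    fin_cases i <;> simp [rotation, h1, h2]
  · have hz : (⟨p 0, p 1⟩ : ℂ) ≠ 0 := by
      intro hz
      have h0 : p 0 = 0 := congrArg Complex.re hz
      have h1 : p 1 = 0 := congrArg Complex.im hz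
      simp [h0, h1] at h
    refine ⟨Complex.arg ⟨p 0, p 1⟩, ![‖(⟨p 0, p 1⟩ : ℂ)‖, 0, p 2], ⟨rfl, norm_pos_iff.2 hz⟩, ?_⟩
    ext i
    fin_cases i <;> simp [rotation, Complex.norm_mul_cos_arg, Complex.norm_mul_sin_arg]
  -- The rotation takes second coordinate 0 to -t v, which fixes t. Invariance of the form u v + y²
  -- and of v then forces the axial coordinate u + y² / v.
  · refine ⟨-p 1 / (p 0 - p 2), RotationKind.parabolic.profilePoint (p 0 - p 2)
      (p 0 + p 2 + p 1 ^ 2 / (p 0 - p 2)), profilePoint_mem_halfPlane _ hs _, ?_⟩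
    have hne := hs.ne'
    ext i
    fin_cases i <;> simp [rotation, profilePoint] <;> field_simp <;> ring

/-- Every point at a positive distance from the axis lies on the orbit of a point of the
half-plane, up to a symmetry of the class. -/
theorem exists_symmetry_rotation {τ : RotationKind} {p : L3} (h : 0 < τ.sqRadius p) :
    ∃ M : L3 ≃ᵃ[ℝ] L3, L3.IsMotion M ∧ M '' τ.axis = τ.axis ∧
      (∀ q, τ.sqRadius (M q) = τ.sqRadius q ∧ L3.form (M q) (M q) = L3.form q q ∧
        (τ ≠ .parabolic → τ.axialCoord (M q) = τ.axialCoord q)) ∧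
      ∃ t : ℝ, ∃ q ∈ τ.halfPlane, M (τ.rotation t q) = p := by
  have hs : τ.side p ≠ 0 := by
    intro h0
    cases τ <;> simp only [sqRadius, side] at h h0
    · rw [h0] at h; nlinarith [sq_nonneg (p 1)]
    · rw [h0] at h; nlinarith [sq_nonneg (p 2)]
    · exact one_ne_zero h0
    · rw [h0] at h; simp at h
  obtain ⟨η, hη⟩ : ∃ η : ℤˣ, 0 < ((η : ℤ) : ℝ) * τ.side p := by
    rcases lt_or_gt_of_ne hs with h | h
    · exact ⟨-1, by simpa using h⟩
    · exact ⟨1, by simpa using h⟩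
  have hη2 := L3.units_cast_sq η
  -- If needed, a sign change makes `side` positive. For the lightlike axis it is the central
  -- symmetry, which reverses the axis; the elliptic class needs none.
  obtain ⟨σ, hσa, hσs, hσr, hσh⟩ : ∃ σ : Fin 3 → ℤˣ,
      (∃ η' : ℤˣ, L3.signFlip σ τ.axisDir = ((η' : ℤ) : ℝ) • τ.axisDir) ∧
      0 < τ.side (L3.signFlip σ p) ∧ (∀ q, τ.sqRadius (L3.signFlip σ q) = τ.sqRadius q) ∧
      (τ ≠ .parabolic → ∀ q, τ.axialCoord (L3.signFlip σ q) = τ.axialCoord q) := by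
    cases τ
    · refine ⟨![1, 1, η], ⟨1, ?_⟩, ?_, fun q => ?_, fun _ q => ?_⟩
      · ext i; fin_cases i <;> simp [axisDir]
      · simpa [side] using hη
      · simp [sqRadius, mul_pow, hη2]
      · simp [axialCoord]
    · refine ⟨![1, η, 1], ⟨1, ?_⟩, ?_, fun q => ?_, fun _ q => ?_⟩
      · ext i; fin_cases i <;> simp [axisDir]
      · simpa [side] using hη
      · simp [sqRadius, mul_pow, hη2]
      · simp [axialCoord]
    · refine ⟨![1, 1, 1], ⟨1, ?_⟩, ?_, fun q => ?_, fun _ q => ?_⟩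
      · ext i; fin_cases i <;> simp [axisDir]
      · simp [side]
      · simp [sqRadius]
      · simp [axialCoord]
    · refine ⟨![η, η, η], ⟨η, ?_⟩, ?_, fun q => ?_, fun h => absurd rfl h⟩
      · ext i; fin_cases i <;> simp [axisDir]
      · simpa [side, mul_sub] using hη
      · simp [sqRadius, ← mul_sub, mul_pow, hη2]
  have hM : ∀ q, L3.signMotion σ ((0 : ℝ) • τ.axisDir) q = L3.signFlip σ q := by
    intro q; ext i; simp [L3.signMotion_apply]
  obtain ⟨t, q, hq, hqp⟩ := exists_rotation_of_side_pos (p := L3.signFlip σ p)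
    (by rw [hσr]; exact h) hσs
  obtain ⟨η', hη'⟩ := hσa
  refine ⟨L3.signMotion σ ((0 : ℝ) • τ.axisDir), L3.isMotion_signMotion _ _,
    signMotion_image_axis τ σ η' 0 hη', fun q => ?_, t, q, hq, ?_⟩
  · rw [hM]
    exact ⟨hσr q, L3.form_signFlip σ q q, fun hτ => hσh hτ q⟩
  · rw [hM, hqp]
    ext i
    simp only [L3.signFlip_apply]
    linear_combination p i * L3.units_cast_sq (σ i)

/-- The generatrix of a quadric is non-null where the tangent plane of the quadric is
non-degenerate. -/
theorem form_ne_zero_of_nondegenerateAt {τ : RotationKind} (hτ : τ ≠ .parabolic) {C D K : ℝ}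
    {p : L3} {r : ℝ} (hr : τ.sqRadius p = r ^ 2)
    (h : NondegenerateAt (fun p => τ.sqRadius p -
      (C * τ.axialCoord p ^ 2 + 2 * D * τ.axialCoord p + K)) p) :
    L3.form (τ.profilePoint (C * τ.axialCoord p + D) r)
      (τ.profilePoint (C * τ.axialCoord p + D) r) ≠ 0 := by
  -- By r r' = (C h + D) h' the profile has velocity proportional to radius component C h + D and
  -- axial component r. Its squared length is, up to a factor ±4, that of the gradient of the
  -- quadric.
  intro h0
  apply h
  have hF : DifferentiableAt ℝ (fun p => τ.sqRadius p -
      (C * τ.axialCoord p ^ 2 + 2 * D * τ.axialCoord p + K)) p := by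
    cases τ <;> simp only [sqRadius, axialCoord] <;> fun_prop
  cases τ
  · rw [fderiv_apply_eq_of_quadratic hF (p 2 ^ 2 - p 1 ^ 2 - (C * p 0 ^ 2 + 2 * D * p 0 + K))
        (-(2 * C * p 0 + 2 * D)) (-C)
        (fun t => by simp [sqRadius, axialCoord]; ring),
      fderiv_apply_eq_of_quadratic hF (p 2 ^ 2 - p 1 ^ 2 - (C * p 0 ^ 2 + 2 * D * p 0 + K))
        (-(2 * p 1)) (-1) (fun t => by simp [sqRadius, axialCoord]; ring),
      fderiv_apply_eq_of_quadratic hF (p 2 ^ 2 - p 1 ^ 2 - (C * p 0 ^ 2 + 2 * D * p 0 + K))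
        (2 * p 2) 1 (fun t => by simp [sqRadius, axialCoord]; ring)]
    simp [L3.form, profilePoint, sqRadius, axialCoord] at h0 hr
    linear_combination -4 * h0 - 4 * hr
  · rw [fderiv_apply_eq_of_quadratic hF (p 1 ^ 2 - p 2 ^ 2 - (C * p 0 ^ 2 + 2 * D * p 0 + K))
        (-(2 * C * p 0 + 2 * D)) (-C)
        (fun t => by simp [sqRadius, axialCoord]; ring),
      fderiv_apply_eq_of_quadratic hF (p 1 ^ 2 - p 2 ^ 2 - (C * p 0 ^ 2 + 2 * D * p 0 + K))
        (2 * p 1) 1 (fun t => by simp [sqRadius, axialCoord]; ring),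
      fderiv_apply_eq_of_quadratic hF (p 1 ^ 2 - p 2 ^ 2 - (C * p 0 ^ 2 + 2 * D * p 0 + K))
        (-(2 * p 2)) (-1) (fun t => by simp [sqRadius, axialCoord]; ring)]
    simp [L3.form, profilePoint, sqRadius, axialCoord] at h0 hr
    linear_combination 4 * h0 + 4 * hr
  · rw [fderiv_apply_eq_of_quadratic hF (p 0 ^ 2 + p 1 ^ 2 - (C * p 2 ^ 2 + 2 * D * p 2 + K))
        (2 * p 0) 1 (fun t => by simp [sqRadius, axialCoord]; ring),
      fderiv_apply_eq_of_quadratic hF (p 0 ^ 2 + p 1 ^ 2 - (C * p 2 ^ 2 + 2 * D * p 2 + K))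
        (2 * p 1) 1 (fun t => by simp [sqRadius, axialCoord]; ring),
      fderiv_apply_eq_of_quadratic hF (p 0 ^ 2 + p 1 ^ 2 - (C * p 2 ^ 2 + 2 * D * p 2 + K))
        (-(2 * C * p 2 + 2 * D)) (-C)
        (fun t => by simp [sqRadius, axialCoord]; ring)]
    simp [L3.form, profilePoint, sqRadius, axialCoord] at h0 hr
    linear_combination -4 * h0 + 4 * hr
  · exact absurd rfl hτ

/-- On the quadric the squared Lorentzian gradient equals 4 (A - C v²) with v = p 0 - p 2; the same
expression governs the derivative of the profile h = A / r + C r. -/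
theorem parabolic_ne_zero_of_nondegenerateAt {A C : ℝ} {p : L3}
    (hp : L3.form p p = A + C * (p 0 - p 2) ^ 2)
    (h : NondegenerateAt (fun p : L3 => L3.form p p - (A + C * (p 0 - p 2) ^ 2)) p) :
    A - C * (p 0 - p 2) ^ 2 ≠ 0 := by
  intro h0
  apply h
  have hF : DifferentiableAt ℝ (fun p : L3 => L3.form p p - (A + C * (p 0 - p 2) ^ 2)) p := by
    simp only [L3.form]; fun_prop
  rw [fderiv_apply_eq_of_quadratic hF (L3.form p p - (A + C * (p 0 - p 2) ^ 2))
      (2 * p 0 - 2 * C * (p 0 - p 2)) (1 - C) (fun t => by simp [L3.form]; ring),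
    fderiv_apply_eq_of_quadratic hF (L3.form p p - (A + C * (p 0 - p 2) ^ 2))
      (2 * p 1) 1 (fun t => by simp [L3.form]; ring),
    fderiv_apply_eq_of_quadratic hF (L3.form p p - (A + C * (p 0 - p 2) ^ 2))
      (-2 * p 2 + 2 * C * (p 0 - p 2)) (-1 - C) (fun t => by simp [L3.form]; ring)]
  simp only [L3.form] at hp
  linear_combination 4 * hp + 4 * h0

end RotationKind

namespace RotationalSurface
variable {S : RotationalSurface}

theorem form_pos_of_hypSecond (hτ : S.kind = .hypSecond) {s : ℝ} (hs : s ∈ S.I) :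
    0 < L3.form (deriv S.γ s) (deriv S.γ s) := by
  have hv := velocity_mem_plane hs
  rw [hτ] at hv
  exact lt_of_le_of_ne (RotationKind.hypSecond_form_nonneg hv) (S.γ_nonnull s hs).symm

theorem isSpacelike_of_causal_sign (h : ∀ s ∈ S.I,
    0 < S.kind.parallelSign * L3.form (deriv S.γ s) (deriv S.γ s)) : S.IsSpacelike := by
  intro s hs t
  have hp := h s hs
  have hr := radius_pos s hs
  -- In the second hyperbolic class the parallels are timelike and the meridians spacelike, so the
  -- assumed positivity excludes it.
  have hc : S.kind.parallelSign = 1 := by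
    by_cases hτ : S.kind = .hypSecond
    · have := form_pos_of_hypSecond hτ hs
      have hc : S.kind.parallelSign = -1 := by rw [hτ]; rfl
      rw [hc] at hp
      linarith
    · cases hk : S.kind <;> first | exact absurd hk hτ | rfl
  rw [firstForm_eq hs]
  rw [hc, one_mul] at hp ⊢
  have e : !![L3.form (deriv S.γ s) (deriv S.γ s), 0; 0, S.kind.radius (S.γ s) ^ 2] =
      Matrix.diagonal ![L3.form (deriv S.γ s) (deriv S.γ s), S.kind.radius (S.γ s) ^ 2] := by
    ext i j
    fin_cases i <;> fin_cases j <;> rfl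
  rw [e]
  refine Matrix.PosDef.diagonal fun i => ?_
  fin_cases i
  · exact hp
  · exact pow_pos hr 2

theorem isTimelike_of_causal_sign (h : ∀ s ∈ S.I,
    S.kind.parallelSign * L3.form (deriv S.γ s) (deriv S.γ s) < 0) : S.IsTimelike := by
  intro s hs t
  rw [firstForm_eq hs, Matrix.det_fin_two_of]
  have := mul_neg_of_neg_of_pos (h s hs) (pow_pos (radius_pos s hs) 2)
  linarith

/-- The same ε decides the causal character and multiplies the constant, so a single μ serves both
cases. -/
theorem causal_dichotomy (S : RotationalSurface) {μ : ℝ} (h : ∀ ε : ℝ, (ε = 1 ∨ ε = -1) →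
    (∀ s ∈ S.I, S.kind.parallelSign * L3.form (deriv S.γ s) (deriv S.γ s) =
      ε * |L3.form (deriv S.γ s) (deriv S.γ s)|) → S.CubicWeingarten (ε * μ)) :
    (S.IsSpacelike ∧ S.CubicWeingarten μ) ∨ (S.IsTimelike ∧ S.CubicWeingarten (-μ)) := by
  obtain ⟨ε, hε, hE⟩ := S.exists_causal_sign
  have := h ε hε hE
  have habs : ∀ s ∈ S.I, 0 < |L3.form (deriv S.γ s) (deriv S.γ s)| :=
    fun s hs => abs_pos.2 (S.γ_nonnull s hs)
  rcases hε with rfl | rfl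
  · refine Or.inl ⟨isSpacelike_of_causal_sign fun s hs => ?_, by simpa using this⟩
    rw [hE s hs, one_mul]
    exact habs s hs
  · refine Or.inr ⟨isTimelike_of_causal_sign fun s hs => ?_, by simpa using this⟩
    rw [hE s hs, neg_one_mul]
    exact neg_neg_of_pos (habs s hs)

/-- A profile that is non-null at `s₀` generates a rotational surface near `s₀`. -/
theorem exists_of_profile (τ : RotationKind) {M : L3 ≃ᵃ[ℝ] L3} (hM : L3.IsMotion M) {U : Set ℝ}
    (hU : IsOpen U) {r h : ℝ → ℝ} (hr : ContDiffOn ℝ 2 r U) (hh : ContDiffOn ℝ 2 h U)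
    (pos : ∀ s ∈ U, 0 < r s) {s₀ r' h' : ℝ} (hs₀ : s₀ ∈ U) (hr' : HasDerivAt r r' s₀)
    (hh' : HasDerivAt h h' s₀)
    (hE : L3.form (τ.profilePoint r' h') (τ.profilePoint r' h') ≠ 0) :
    ∃ S : RotationalSurface, S.kind = τ ∧ S.motion = M ∧ S.I ⊆ U ∧ s₀ ∈ S.I ∧
      ∀ s, S.γ s = τ.profilePoint (r s) (h s) := by
  set γ : ℝ → L3 := fun s => τ.profilePoint (r s) (h s) with hγ
  have hγd : ContDiffOn ℝ 2 γ U := τ.contDiffOn_profilePoint hr hh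
  have hd : ContinuousOn (deriv γ) U :=
    (((contDiffOn_succ_iff_deriv_of_isOpen (n := 1) hU).1 hγd).2.2).continuousOn
  have hi : ∀ i, ContinuousOn (fun s => deriv γ s i) U := continuousOn_pi.1 hd
  have hc : ContinuousOn (fun s => L3.form (deriv γ s) (deriv γ s)) U :=
    (((hi 0).mul (hi 0)).add ((hi 1).mul (hi 1))).sub ((hi 2).mul (hi 2))
  have hV : IsOpen {s ∈ U | L3.form (deriv γ s) (deriv γ s) ≠ 0} :=
    hc.isOpen_inter_preimage hU isOpen_ne
  have hs : s₀ ∈ {s ∈ U | L3.form (deriv γ s) (deriv γ s) ≠ 0} := by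
    refine ⟨hs₀, ?_⟩
    rw [(τ.hasDerivAt_profilePoint hr' hh').deriv]
    exact hE
  obtain ⟨δ, hδ, hball⟩ := Metric.isOpen_iff.1 hV s₀ hs
  exact ⟨{
    kind := τ
    motion := M
    isMotion := hM
    I := Metric.ball s₀ δ
    I_open := Metric.isOpen_ball
    I_nonempty := ⟨s₀, Metric.mem_ball_self hδ⟩
    I_connected := by rw [Real.ball_eq_Ioo]; exact ordConnected_Ioo
    γ := γ
    γ_contDiff := hγd.mono fun s hs => (hball hs).1
    γ_mem := fun s hs => τ.profilePoint_mem_halfPlane (pos s (hball hs).1) _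
    γ_nonnull := fun s hs => (hball hs).2 }, rfl, rfl, fun s hs => (hball hs).1,
    Metric.mem_ball_self hδ, fun _ => rfl⟩

theorem exists_of_plane {τ : RotationKind} (hτ : τ ≠ .parabolic) {c : ℝ} {p : L3}
    (hp : τ.axialCoord p - c = 0) (hpos : 0 < τ.sqRadius p) :
    ∃ S : RotationalSurface, S.kind = τ ∧ S.axis = τ.axis ∧ p ∈ S.carrier ∧
      S.carrier ⊆ {q | τ.axialCoord q - c = 0} ∧
      ((S.IsSpacelike ∧ S.CubicWeingarten 1) ∨ (S.IsTimelike ∧ S.CubicWeingarten (-1))) := by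
  obtain ⟨M, hM, hax, hinv, t, q, hq, hqp⟩ := RotationKind.exists_symmetry_rotation hpos
  have hqa : τ.axialCoord q = c := by
    rw [← hqp, (hinv _).2.2 hτ, RotationKind.axialCoord_rotation hτ] at hp
    linarith
  obtain ⟨S, rfl, rfl, hI, hs₀, hγ⟩ := exists_of_profile τ hM (isOpen_Ioi (a := (0 : ℝ)))
    (r := fun s => s) (h := fun _ => c) contDiffOn_id contDiffOn_const (fun s hs => hs)
    (s₀ := τ.radius q) (RotationKind.radius_pos_of_mem_halfPlane hq) (hasDerivAt_id _)
    (hasDerivAt_const _ _)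
    (by cases τ <;> first | exact absurd rfl hτ | simp [L3.form, RotationKind.profilePoint])
  refine ⟨S, rfl, hax, ⟨_, hs₀, t, ?_⟩, ?_, S.causal_dichotomy fun ε _ _ =>
    cubicWeingarten_of_axialCoord_eq_const hτ (c := c) (fun s _ => by simp [hγ]) _⟩
  · rw [X, hγ, ← hqa, RotationKind.profilePoint_of_mem_plane
      (RotationKind.mem_plane_of_mem_halfPlane hq), hqp]
  · rintro _ ⟨s, hs, t, rfl⟩
    simp [X, (hinv _).2.2 hτ, RotationKind.axialCoord_rotation hτ, hγ]

/-- Near the given point the generatrix is the graph r = √(f h), with h as parameter. -/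
theorem exists_of_quadric {τ : RotationKind} (hτ : τ ≠ .parabolic) {C D K : ℝ} {p : L3}
    (hp : τ.sqRadius p - (C * τ.axialCoord p ^ 2 + 2 * D * τ.axialCoord p + K) = 0)
    (hpos : 0 < τ.sqRadius p) (hnd : NondegenerateAt (fun p => τ.sqRadius p -
      (C * τ.axialCoord p ^ 2 + 2 * D * τ.axialCoord p + K)) p) :
    ∃ S : RotationalSurface, S.kind = τ ∧ S.axis = τ.axis ∧ p ∈ S.carrier ∧
      S.carrier ⊆
        {q | τ.sqRadius q - (C * τ.axialCoord q ^ 2 + 2 * D * τ.axialCoord q + K) = 0} ∧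
      ((S.IsSpacelike ∧ S.CubicWeingarten (τ.bendFactor * (C * K - D ^ 2))) ∨
        (S.IsTimelike ∧ S.CubicWeingarten (-(τ.bendFactor * (C * K - D ^ 2))))) := by
  obtain ⟨M, hM, hax, hinv, t, q, hq, hqp⟩ := RotationKind.exists_symmetry_rotation hpos
  have hqpl := RotationKind.mem_plane_of_mem_halfPlane hq
  have hr := RotationKind.radius_pos_of_mem_halfPlane hq
  have ha : τ.axialCoord p = τ.axialCoord q := by
    rw [← hqp, (hinv _).2.2 hτ, RotationKind.axialCoord_rotation hτ]
  have hρ : τ.sqRadius p = τ.radius q ^ 2 := by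
    rw [← hqp, (hinv _).1, RotationKind.sqRadius_rotation,
      RotationKind.sqRadius_of_mem_plane hqpl]
  have hE := RotationKind.form_ne_zero_of_nondegenerateAt hτ hρ hnd
  rw [ha, hρ] at hp
  rw [ha] at hE
  set f : ℝ → ℝ := fun s => C * s ^ 2 + 2 * D * s + K with hf
  have hf0 : f (τ.axialCoord q) = τ.radius q ^ 2 := by simp only [hf]; linarith
  have hfc : ContDiff ℝ 2 f := by simp only [hf]; fun_prop
  have hfd : HasDerivAt f (2 * (C * τ.axialCoord q + D)) (τ.axialCoord q) :=
    (((((hasDerivAt_id _).fun_pow 2).const_mul C).add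
      ((hasDerivAt_id _).const_mul (2 * D))).add_const K).congr_deriv (by simp; ring)
  have hsq : Real.sqrt (f (τ.axialCoord q)) = τ.radius q := by
    rw [hf0, Real.sqrt_sq hr.le]
  have hsd : HasDerivAt (fun s => Real.sqrt (f s)) ((C * τ.axialCoord q + D) / τ.radius q)
      (τ.axialCoord q) := by
    refine (hfd.sqrt (by rw [hf0]; positivity)).congr_deriv ?_
    rw [hsq]
    field_simp
  obtain ⟨S, rfl, rfl, hI, hs₀, hγ⟩ := exists_of_profile τ hM
    (isOpen_lt continuous_const hfc.continuous : IsOpen {s | 0 < f s})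
    (r := fun s => Real.sqrt (f s)) (h := fun s => s)
    (hfc.contDiffOn.sqrt fun s hs => (ne_of_gt hs)) contDiffOn_id
    (fun s hs => Real.sqrt_pos.2 hs) (s₀ := τ.axialCoord q)
    (by rw [mem_ofPred_eq, hf0]; positivity) hsd (hasDerivAt_id _) (by
      intro h0
      apply hE
      -- The vector supplied by non-degeneracy is r times the velocity of the graph.
      have e : τ.profilePoint (C * τ.axialCoord q + D) (τ.radius q) =
          τ.radius q • τ.profilePoint ((C * τ.axialCoord q + D) / τ.radius q) 1 := by
        ext i
        cases τ <;> first
          | exact absurd rfl hτ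
          | fin_cases i <;> (simp [RotationKind.profilePoint]; try field_simp)
      rw [e, L3.form_smul_left, L3.form_smul_right, h0]
      simp)
  have hprof : ∀ s ∈ S.I, S.kind.radius (S.γ s) ^ 2 =
      C * S.kind.axialCoord (S.γ s) ^ 2 + 2 * D * S.kind.axialCoord (S.γ s) + K := by
    intro s hs
    have : 0 < f s := hI hs
    rw [hγ, RotationKind.radius_profilePoint, RotationKind.axialCoord_profilePoint,
      Real.sq_sqrt this.le]
  refine ⟨S, rfl, hax, ⟨_, hs₀, t, ?_⟩, ?_, S.causal_dichotomy fun ε hε hE =>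
    cubicWeingarten_of_profile hτ hε hE hprof⟩
  · rw [X, hγ, hsq, RotationKind.profilePoint_of_mem_plane hqpl, hqp]
  · rintro _ ⟨s, hs, t, rfl⟩
    simp only [mem_ofPred_eq, X, (hinv _).2.2 hτ, RotationKind.axialCoord_rotation hτ,
      (hinv _).1, sqRadius_rotation_γ hs, hprof s hs, sub_self]

theorem exists_of_parabolic_quadric {A C : ℝ} {p : L3}
    (hp : L3.form p p - (A + C * (p 0 - p 2) ^ 2) = 0)
    (hpos : 0 < RotationKind.parabolic.sqRadius p)
    (hnd : NondegenerateAt (fun p : L3 => L3.form p p - (A + C * (p 0 - p 2) ^ 2)) p) :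
    ∃ S : RotationalSurface, S.kind = .parabolic ∧ S.axis = RotationKind.parabolic.axis ∧
      p ∈ S.carrier ∧ S.carrier ⊆ {q | L3.form q q - (A + C * (q 0 - q 2) ^ 2) = 0} ∧
      ((S.IsSpacelike ∧ S.CubicWeingarten (-A)) ∨ (S.IsTimelike ∧ S.CubicWeingarten (-(-A)))) := by
  have hE := RotationKind.parabolic_ne_zero_of_nondegenerateAt (by linarith) hnd
  change L3.form p p - (A + C * RotationKind.parabolic.sqRadius p) = 0 at hp
  change A - C * RotationKind.parabolic.sqRadius p ≠ 0 at hE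
  change ∃ S : RotationalSurface, S.kind = .parabolic ∧ S.axis = RotationKind.parabolic.axis ∧
      p ∈ S.carrier ∧
      S.carrier ⊆ {q | L3.form q q - (A + C * RotationKind.parabolic.sqRadius q) = 0} ∧ _
  obtain ⟨M, hM, hax, hinv, t, q, hq, hqp⟩ := RotationKind.exists_symmetry_rotation hpos
  generalize hτ : RotationKind.parabolic = τ at *
  have hqpl := RotationKind.mem_plane_of_mem_halfPlane hq
  have hr := RotationKind.radius_pos_of_mem_halfPlane hq
  have hff : ∀ {v : L3}, v ∈ τ.plane → L3.form v v = τ.axialCoord v * τ.radius v := by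
    subst hτ
    exact RotationKind.parabolic_form_of_mem_plane
  have hρ : τ.sqRadius p = τ.radius q ^ 2 := by
    rw [← hqp, (hinv _).1, RotationKind.sqRadius_rotation,
      RotationKind.sqRadius_of_mem_plane hqpl]
  have hform : L3.form p p = τ.axialCoord q * τ.radius q := by
    rw [← hqp, (hinv _).2.1, RotationKind.form_rotation, hff hqpl]
  rw [hform, hρ] at hp
  rw [hρ] at hE
  set r₀ := τ.radius q with hr₀
  -- The equation h r = A + C r² is solved for h, with r as parameter.
  have hd : HasDerivAt (fun s : ℝ => A * s⁻¹ + C * s) (A * -(r₀ ^ 2)⁻¹ + C * 1) r₀ :=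
    ((hasDerivAt_inv hr.ne').const_mul A).add ((hasDerivAt_id r₀).const_mul C)
  have hcd : ContDiffOn ℝ 2 (fun s : ℝ => A * s⁻¹ + C * s) (Ioi 0) :=
    (contDiffOn_const.mul (contDiffOn_id.inv fun s hs => ne_of_gt hs)).add
      (contDiffOn_const.mul contDiffOn_id)
  have hform' : ∀ a b, L3.form (τ.profilePoint a b) (τ.profilePoint a b) = b * a := by
    subst hτ
    intro a b
    simp [L3.form, RotationKind.profilePoint]; ring
  obtain ⟨S, rfl, rfl, hI, hs₀, hγ⟩ := exists_of_profile τ hM (isOpen_Ioi (a := (0 : ℝ)))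
    (r := fun s => s) contDiffOn_id hcd (fun s hs => hs) (s₀ := r₀) hr (hasDerivAt_id _) hd (by
      rw [hform']
      intro h0
      apply hE
      field_simp at h0
      linear_combination -h0)
  have hprof : ∀ s ∈ S.I, S.kind.axialCoord (S.γ s) * S.kind.radius (S.γ s) =
      A + C * S.kind.radius (S.γ s) ^ 2 + 0 * S.kind.radius (S.γ s) := by
    intro s hs
    have : 0 < s := hI hs
    rw [hγ, RotationKind.radius_profilePoint, RotationKind.axialCoord_profilePoint]
    field_simp
    ring
  have haq : A * r₀⁻¹ + C * r₀ = S.kind.axialCoord q := by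
    field_simp
    linear_combination -hp
  refine ⟨S, rfl, hax, ⟨_, hs₀, t, ?_⟩, ?_, S.causal_dichotomy fun ε hε hE =>
    cubicWeingarten_of_parabolic_profile hτ.symm hε hE hprof⟩
  · rw [X, hγ, haq, RotationKind.profilePoint_of_mem_plane hqpl, hqp]
  · rintro _ ⟨s, hs, t, rfl⟩
    simp only [mem_ofPred_eq, X, (hinv _).2.1, RotationKind.form_rotation, hff (γ_mem_plane hs),
      (hinv _).1, sqRadius_rotation_γ hs, hprof s hs]
    ring

end RotationalSurface

end

theorem theorem7p1 :
    -- a rotational surface satisfies a cubic Weingarten relation if and only if it is (part of) a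
    -- plane or a non-degenerate quadric surface of revolution of its class, up to an isometry
    -- that matches the axes of revolution
    (∀ S : RotationalSurface,
      (∃ μ : ℝ, μ ≠ 0 ∧ S.CubicWeingarten μ) ↔
        ∃ (Ψ : L3 ≃ᵃ[ℝ] L3) (F : L3 → ℝ),
          L3.IsMotion Ψ ∧ Ψ '' S.kind.axis = S.axis ∧
          (IsPlaneOfRevolution S.kind F ∨ IsQuadricOfRevolution S.kind F) ∧
          S.carrier ⊆ Ψ '' {p | F p = 0}) ∧
    -- all the planes and quadrics in the list occur: the part of them that is swept out by
    -- generatrices of the class considered, minus the degenerate points, consists of rotational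
    -- surfaces that satisfy the relation, with one constant up to the sign, which is governed by
    -- the causal character
    (∀ (τ : RotationKind) (F : L3 → ℝ),
      (IsPlaneOfRevolution τ F ∨ IsQuadricOfRevolution τ F) →
      ∃ μ : ℝ, μ ≠ 0 ∧
        ∀ p : L3, F p = 0 → 0 < τ.sqRadius p → NondegenerateAt F p →
          ∃ S : RotationalSurface, S.kind = τ ∧ S.axis = τ.axis ∧
            p ∈ S.carrier ∧ S.carrier ⊆ {q | F q = 0} ∧
            ((S.IsSpacelike ∧ S.CubicWeingarten μ) ∨
              (S.IsTimelike ∧ S.CubicWeingarten (-μ)))) := by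
  refine ⟨fun S => S.exists_cubicWeingarten_iff, fun τ F hF => ?_⟩
  rcases hF with ⟨hτ, c, rfl⟩ | hF
  · exact ⟨1, one_ne_zero, fun p hp hpos _ => RotationalSurface.exists_of_plane hτ hp hpos⟩
  · by_cases hτ : τ = .parabolic
    · subst hτ
      obtain ⟨A, C, hA, rfl⟩ := hF.exists_parabolic_profile
      exact ⟨-A, neg_ne_zero.2 hA, fun p hp hpos hnd =>
        RotationalSurface.exists_of_parabolic_quadric hp hpos hnd⟩
    · obtain ⟨C, D, K, hd, rfl⟩ := hF.exists_profile hτ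
      have hb : τ.bendFactor ≠ 0 := by
        have := RotationKind.bendFactor_sq hτ
        rintro h
        simp [h] at this
      refine ⟨τ.bendFactor * (C * K - D ^ 2), mul_ne_zero hb fun h0 => hd (by linarith),
        fun p hp hpos hnd => RotationalSurface.exists_of_quadric hτ hp hpos hnd⟩
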